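/- **Proposition 4 (Morse index equality).** Let $n\in\mathbb N$, $T>0$, $q_0,q_T\in\mathbb R^n$, and let $V\in C^2(\mathbb R^n,\mathbb R)$ satisfy $C:=\sup_{q}|V''(q)|<\infty$ (operator norm). Let $\mathcal H=H^1_0([0,T],\mathbb R^n)$ with inner product $\langle c,d\rangle=\int_0^T\dot c\cdot\dot d\,dt$, and for $c\in\mathcal H$ put $$L(c)=\int_0^T\Big(\tfrac12|\dot\gamma(t)|^2-V(\gamma(t))\Big)dt,\qquad \gamma(t)=q_0+\tfrac tT(q_T-q_0)+c(t).$$ Let $N$ be a natural number with $N\ge\lfloor T\sqrt C/\pi\rfloor$, let $\mathcal U_N\subset\mathcal H$ be the span of the curves $t\mapsto\sqrt{2/T}\,\sin(k\pi t/T)\,e_j$ with $1\le k\le N$, $1\le j\le n$, and let $\mathcal V_N=\mathcal U_N^\perp$. Then $L$ is of class $C^2$ on $\mathcal H$, and there is exactly one map $\tilde v:\mathcal U_N\to\mathcal V_N$ such that, for all $u\in\mathcal U_N$ and $v\in\mathcal V_N$, $dL(u+v)$ vanishes on $\mathcal V_N$ if and only if $v=\tilde v(u)$. This map is of class $C^1$,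 and the reduced functional $S(u)=L(u+\tilde v(u))$ on $\mathcal U_N$ is of class $C^2$. For $u\in\mathcal U_N$ and $c=u+\tilde v(u)$, one has $dS(u)=0$ if and only if $dL(c)=0$; and in that case 1. the index of $d^2L(c)$ (the maximal dimension of a linear subspace of $\mathcal H$ on which $d^2L(c)$ is negative definite) equals the index of $d^2S(u)$ on $\mathcal U_N$; 2. the nullity of $d^2L(c)$ (the dimension of its kernel) equals the nullity of $d^2S(u)$; 3. the index of $d^2L(c)$ is at most $nN$. -/

import Mathlib

open MeasureTheory Set

namespace Reduction

/-- Configuration space `ℝⁿ` with its Euclidean norm. -/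
abbrev Conf (n : ℕ) : Type := EuclideanSpace ℝ (Fin n)

/-! ### The Hilbert space `H¹₀([0,T], ℝⁿ)` -/

/-- Absolutely continuous curves are differentiable almost everywhere. -/
theorem ae_differentiableAt {n : ℕ} {T : ℝ} {c : ℝ → Conf n}
    (hc : AbsolutelyContinuousOnInterval c 0 T) :
    ∀ᵐ t ∂(volume.restrict (Ioo 0 T)), DifferentiableAt ℝ c t := by
  rw [ae_restrict_iff' measurableSet_Ioo]
  filter_upwards [hc.boundedVariationOn.ae_differentiableAt_of_mem_uIcc] with t ht h
  refine ht ?_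
  rw [mem_uIcc]
  exact Or.inl ⟨h.1.le, h.2.le⟩

theorem deriv_add_ae {n : ℕ} {T : ℝ} {c d : ℝ → Conf n}
    (hc : AbsolutelyContinuousOnInterval c 0 T) (hd : AbsolutelyContinuousOnInterval d 0 T) :
    deriv (c + d) =ᵐ[volume.restrict (Ioo 0 T)] deriv c + deriv d := by
  filter_upwards [ae_differentiableAt hc, ae_differentiableAt hd] with t h1 h2
  exact deriv_add h1 h2

theorem deriv_const_smul_ae {n : ℕ} {T : ℝ} {c : ℝ → Conf n} (a : ℝ)
    (hc : AbsolutelyContinuousOnInterval c 0 T) :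
    deriv (a • c) =ᵐ[volume.restrict (Ioo 0 T)] a • deriv c := by
  filter_upwards [ae_differentiableAt hc] with t h1
  exact deriv_const_smul a h1

/-- The curves of class `H¹` on `[0,T]` which vanish at `0` and `T`: absolutely continuous curves
with square integrable derivative. A curve on `[0,T]` is represented by its extension by zero
to the real line. -/
def H10Submodule (n : ℕ) (T : ℝ) : Submodule ℝ (ℝ → Conf n) where
  carrier := {c | AbsolutelyContinuousOnInterval c 0 T ∧
    MemLp (deriv c) 2 (volume.restrict (Ioo 0 T)) ∧ ∀ t, t ∉ Ioo 0 T → c t = 0}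
  zero_mem' := by
    refine ⟨?_, ?_, fun t _ => rfl⟩
    · exact ((LipschitzWith.const (0 : Conf n)).lipschitzOnWith
        (s := uIcc 0 T)).absolutelyContinuousOnInterval
    · have h : deriv (0 : ℝ → Conf n) = fun _ => 0 := by
        funext t
        exact deriv_const t (0 : Conf n)
      rw [h]
      exact MemLp.zero
  add_mem' := by
    rintro c d ⟨hc, hc2, hc0⟩ ⟨hd, hd2, hd0⟩
    refine ⟨hc.add hd, (memLp_congr_ae (deriv_add_ae hc hd)).2 (hc2.add hd2), fun t ht => ?_⟩
    simp [hc0 t ht, hd0 t ht]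
  smul_mem' := by
    rintro a c ⟨hc, hc2, hc0⟩
    refine ⟨hc.const_smul a, (memLp_congr_ae (deriv_const_smul_ae a hc)).2 (hc2.const_smul a),
      fun t ht => ?_⟩
    simp [hc0 t ht]

/-- The space `H¹₀([0,T], ℝⁿ)`. -/
def H10 (n : ℕ) (T : ℝ) : Type := ↥(H10Submodule n T)

instance (n : ℕ) (T : ℝ) : AddCommGroup (H10 n T) :=
  inferInstanceAs (AddCommGroup ↥(H10Submodule n T))

instance (n : ℕ) (T : ℝ) : Module ℝ (H10 n T) :=
  inferInstanceAs (Module ℝ ↥(H10Submodule n T))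

/-- The curve underlying an element of `H¹₀([0,T], ℝⁿ)`. -/
def H10.curve {n : ℕ} {T : ℝ} (c : H10 n T) : ℝ → Conf n := c.1

theorem H10.integrable_inner {n : ℕ} {T : ℝ} (c d : H10 n T) :
    Integrable (fun t => inner ℝ (deriv c.curve t) (deriv d.curve t))
      (volume.restrict (Ioo 0 T)) := by
  have h := L2.integrable_inner (𝕜 := ℝ) (c.2.2.1.toLp _) (d.2.2.1.toLp _)
  refine h.congr ?_
  filter_upwards [c.2.2.1.coeFn_toLp, d.2.2.1.coeFn_toLp] with t h1 h2
  rw [h1, h2]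
  rfl

theorem H10.eq_zero_of_integral {n : ℕ} {T : ℝ} (c : H10 n T)
    (h : ∫ t in Ioo 0 T, inner ℝ (deriv c.curve t) (deriv c.curve t) = 0) : c = 0 := by
  apply Subtype.ext
  funext t
  change c.1 t = 0
  by_cases ht : t ∈ Ioo 0 T
  swap
  · exact c.2.2.2 t ht
  have hT : 0 < T := ht.1.trans ht.2
  have h0 := (integral_eq_zero_iff_of_nonneg (fun s => real_inner_self_nonneg)
    (c.integrable_inner c)).1 h
  have hz : ∀ᵐ s, s ∈ uIcc 0 T → HasDerivAt c.1 0 s := by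
    have e0 : ∀ᵐ s : ℝ, s ≠ 0 := by simp [ae_iff, measure_singleton]
    have eT : ∀ᵐ s : ℝ, s ≠ T := by simp [ae_iff, measure_singleton]
    have h1 := (ae_restrict_iff' measurableSet_Ioo).1 h0
    have h2 := (ae_restrict_iff' measurableSet_Ioo).1 (ae_differentiableAt c.2.1)
    filter_upwards [e0, eT, h1, h2] with s hs0 hsT h1 h2 hs
    rw [uIcc_of_le hT.le] at hs
    have hs' : s ∈ Ioo 0 T := ⟨lt_of_le_of_ne hs.1 hs0.symm, lt_of_le_of_ne hs.2 hsT⟩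
    have h3 : deriv c.1 s = 0 := inner_self_eq_zero.1 (h1 hs')
    rw [← h3]
    exact (h2 hs').hasDerivAt
  obtain ⟨K, hK⟩ := c.2.1.const_of_ae_hasDerivAt_zero hz
  rw [uIcc_of_le hT.le] at hK
  rw [hK t ⟨ht.1.le, ht.2.le⟩, ← hK 0 ⟨le_refl _, hT.le⟩]
  exact c.2.2.2 0 (by simp)

/-- The inner product `⟨c, d⟩ = ∫₀ᵀ ċ(t) · ḋ(t) dt` on `H¹₀([0,T], ℝⁿ)`. -/
@[reducible]
noncomputable def H10.core (n : ℕ) (T : ℝ) : InnerProductSpace.Core ℝ (H10 n T) where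
  inner c d := ∫ t in Ioo 0 T, inner ℝ (deriv c.curve t) (deriv d.curve t)
  conj_inner_symm c d := by
    simp only [conj_trivial]
    exact integral_congr_ae (Filter.Eventually.of_forall fun t => real_inner_comm _ _)
  re_inner_nonneg c := integral_nonneg fun t => real_inner_self_nonneg
  add_left c d e := by
    rw [← integral_add (c.integrable_inner e) (d.integrable_inner e)]
    refine integral_congr_ae ?_
    filter_upwards [deriv_add_ae c.2.1 d.2.1] with t ht
    have h : deriv (c + d).curve t = deriv c.curve t + deriv d.curve t := ht
    rw [h, inner_add_left]
  smul_left c d a := by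
    simp only [conj_trivial]
    rw [← integral_const_mul]
    refine integral_congr_ae ?_
    filter_upwards [deriv_const_smul_ae a c.2.1] with t ht
    have h : deriv (a • c).curve t = a • deriv c.curve t := ht
    rw [h, real_inner_smul_left]
  definite c h := c.eq_zero_of_integral h

noncomputable instance (n : ℕ) (T : ℝ) : NormedAddCommGroup (H10 n T) :=
  (H10.core n T).toNormedAddCommGroup

noncomputable instance (n : ℕ) (T : ℝ) : InnerProductSpace ℝ (H10 n T) :=
  InnerProductSpace.ofCore (H10.core n T).toCore

/-! ### The action functional -/

/-- The curve `ι(c)(t) = q₀ + (t/T) (q_T - q₀) + c(t)` from `q₀` to `q_T`. -/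
noncomputable def path {n : ℕ} {T : ℝ} (q₀ qT : Conf n) (c : H10 n T) (t : ℝ) : Conf n :=
  q₀ + (t / T) • (qT - q₀) + c.curve t

/-- The action `L(c) = ∫₀ᵀ (|γ̇(t)|² / 2 - V(γ(t))) dt` of the curve `γ = ι(c)`. -/
noncomputable def action {n : ℕ} {T : ℝ} (V : Conf n → ℝ) (q₀ qT : Conf n) (c : H10 n T) : ℝ :=
  ∫ t in (0 : ℝ)..T, (1 / 2 * ‖deriv (path q₀ qT c) t‖ ^ 2 - V (path q₀ qT c t))

/-! ### The decomposition `H¹₀ = 𝒰_N ⊕ 𝒱_N` -/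

/-- The curve `t ↦ √(2/T) sin(k π t / T) e_j` on `[0,T]`, extended by zero. -/
noncomputable def sineCurve (n : ℕ) (T : ℝ) (k : ℕ) (j : Fin n) : ℝ → Conf n :=
  (Ioo 0 T).indicator fun t =>
    (√(2 / T) * Real.sin (k * Real.pi * t / T)) • EuclideanSpace.single j (1 : ℝ)

theorem sineCurve_mem (n : ℕ) (T : ℝ) (k : ℕ) (j : Fin n) :
    sineCurve n T k j ∈ H10Submodule n T := by
  rcases le_or_gt T 0 with hT | hT
  · have h : sineCurve n T k j = 0 := by
      unfold sineCurve
      rw [Ioo_eq_empty (not_lt.2 hT), indicator_empty]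
      rfl
    rw [h]
    exact zero_mem _
  have hT' : T ≠ 0 := hT.ne'
  set g : ℝ → Conf n := fun t =>
    (√(2 / T) * Real.sin (k * Real.pi * t / T)) • EuclideanSpace.single j (1 : ℝ) with hg
  have hgd : ContDiff ℝ 1 g := by
    rw [hg]
    fun_prop
  have heq : EqOn (sineCurve n T k j) g (uIcc 0 T) := by
    intro t ht
    rw [uIcc_of_le hT.le] at ht
    by_cases h : t ∈ Ioo 0 T
    · exact indicator_of_mem h _
    · have h1 : sineCurve n T k j t = 0 := indicator_of_notMem h _
      have h2 : t = 0 ∨ t = T := by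
        by_contra hh
        push Not at hh
        exact h ⟨lt_of_le_of_ne ht.1 hh.1.symm, lt_of_le_of_ne ht.2 hh.2⟩
      rw [h1]
      rcases h2 with rfl | rfl
      · simp [hg]
      · simp only [hg]
        rw [mul_div_assoc, div_self hT', mul_one, Real.sin_nat_mul_pi]
        simp
  refine ⟨?_, ?_, fun t ht => indicator_of_notMem ht _⟩
  · obtain ⟨K, hK⟩ := hgd.locallyLipschitz.locallyLipschitzOn.exists_lipschitzOnWith_of_compact
      (isCompact_uIcc (a := (0 : ℝ)) (b := T))
    have hK' : LipschitzOnWith K (sineCurve n T k j) (uIcc 0 T) := by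
      intro x hx y hy
      rw [heq hx, heq hy]
      exact hK hx hy
    exact hK'.absolutelyContinuousOnInterval
  · have hd : deriv (sineCurve n T k j) =ᵐ[volume.restrict (Ioo 0 T)] deriv g := by
      rw [Filter.EventuallyEq, ae_restrict_iff' measurableSet_Ioo]
      refine Filter.Eventually.of_forall fun t ht => ?_
      refine Filter.EventuallyEq.deriv_eq ?_
      filter_upwards [isOpen_Ioo.mem_nhds ht] with s hs
      exact indicator_of_mem hs _
    rw [memLp_congr_ae hd]
    have hc : Continuous (deriv g) := hgd.continuous_deriv le_rfl
    obtain ⟨M, hM⟩ := (isCompact_Icc (a := (0 : ℝ)) (b := T)).exists_bound_of_continuousOn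
      hc.continuousOn
    refine MemLp.of_bound hc.aestronglyMeasurable M ?_
    rw [ae_restrict_iff' measurableSet_Ioo]
    exact Filter.Eventually.of_forall fun t ht => hM t (Ioo_subset_Icc_self ht)

/-- The basis element `φ_k^j` of `H¹₀([0,T], ℝⁿ)`. -/
noncomputable def sineBasis (n : ℕ) (T : ℝ) (k : ℕ) (j : Fin n) : H10 n T :=
  ⟨sineCurve n T k j, sineCurve_mem n T k j⟩

/-- `𝒰_N`, spanned by the `φ_k^j` with `1 ≤ k ≤ N` and `1 ≤ j ≤ n`. -/
noncomputable def lowModes (n : ℕ) (T : ℝ) (N : ℕ) : Submodule ℝ (H10 n T) :=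
  Submodule.span ℝ {c | ∃ k : ℕ, 1 ≤ k ∧ k ≤ N ∧ ∃ j : Fin n, c = sineBasis n T k j}

/-- `𝒱_N`, the orthogonal complement of `𝒰_N`. -/
noncomputable def highModes (n : ℕ) (T : ℝ) (N : ℕ) : Submodule ℝ (H10 n T) :=
  (lowModes n T N)ᗮ

/-- The map `w : 𝒰_N → 𝒱_N` solves the `𝒱_N`-component of the equation `dL = 0`: for `u ∈ 𝒰_N` and
`v ∈ 𝒱_N`, the differential of `L` at `u + v` vanishes on `𝒱_N` if and only if `v = w u`. -/
def IsReduction {n : ℕ} {T : ℝ} (L : H10 n T → ℝ) (N : ℕ)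
    (w : lowModes n T N → highModes n T N) : Prop :=
  ∀ (u : lowModes n T N) (v : highModes n T N),
    (∀ δ : highModes n T N, fderiv ℝ L ((u : H10 n T) + (v : H10 n T)) (δ : H10 n T) = 0) ↔ v = w u

/-- The point `u + w u` of `H¹₀`. -/
def lift {n : ℕ} {T : ℝ} {N : ℕ} (w : lowModes n T N → highModes n T N)
    (u : lowModes n T N) : H10 n T :=
  (u : H10 n T) + (w u : H10 n T)

/-- The reduced functional `S(u) = L(u + w u)` on `𝒰_N`. -/
def reduced {n : ℕ} {T : ℝ} {N : ℕ} (L : H10 n T → ℝ)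
    (w : lowModes n T N → highModes n T N) (u : lowModes n T N) : ℝ :=
  L (lift w u)

/-! ### Index and nullity -/

section Index

variable {E : Type*} [NormedAddCommGroup E] [NormedSpace ℝ E]

/-- The second Fréchet derivative, as a bilinear form. -/
noncomputable def hessian (f : E → ℝ) (x : E) : E →L[ℝ] E →L[ℝ] ℝ :=
  fderiv ℝ (fderiv ℝ f) x

/-- `W` is a negative subspace for the bilinear form `B`. -/
def IsNegative (B : E →L[ℝ] E →L[ℝ] ℝ) (W : Submodule ℝ E) : Prop :=
  ∀ x ∈ W, x ≠ 0 → B x x < 0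

/-- The index of a bilinear form: the maximal dimension (possibly `∞`) of a negative subspace. -/
noncomputable def index (B : E →L[ℝ] E →L[ℝ] ℝ) : ℕ∞ :=
  ⨆ W : {W : Submodule ℝ E // IsNegative B W}, Cardinal.toENat (Module.rank ℝ W.1)

/-- The nullity of a bilinear form: the dimension (possibly `∞`) of its kernel
`{x | B x y = 0 for all y}`. -/
noncomputable def nullity (B : E →L[ℝ] E →L[ℝ] ℝ) : ℕ∞ :=
  Cardinal.toENat (Module.rank ℝ (LinearMap.ker (B : E →ₗ[ℝ] E →L[ℝ] ℝ)))

end Index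

end Reduction

/-!
Since `∫ ċ = 0` for `c` in `H¹₀`, the action is `L(c) = const + ‖c‖² / 2 - G(c)` with
`G(c) = ∫ V(γ)`, so that `⟨x, y⟩ - d²L(c)(x, y) = ∫ V''(γ)(x, y)`. Odd reflection to `[-T, T]` and
Parseval's identity give Wirtinger's inequality `∫ |v|² ≤ (T / ((N + 1) π))² ‖v‖²` on `𝒱_N`
(`H10.integral_norm_sq_le`). Hence on `𝒱_N` the Hessian of `L` differs from the inner product by at
most `κ = C (T / ((N + 1) π))²` (`hessianClose_action`), and `κ < 1` is what the hypothesis on `N`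
says (`contraction_constant_lt_one`).

The rest is Lyapunov-Schmidt reduction for a `C²` function on a Hilbert space whose Hessian is
`κ`-close to the inner product on `Uᗮ`. With `P` the projection to `Uᗮ`, the map
`x ↦ P (P x - ∇L(u + P x))` is a `κ`-contraction, whose fixed point is `w(u)`
(`existsUnique_vertical_critical`). The inverse function theorem for `c ↦ c - P c + P ∇L(c)` shows
that `w` is `C¹` (`contDiff_vertical_critical`). As `dL` vanishes on `Uᗮ` along the graph of `w`,
`dS(u)` is the restriction of `dL(u + w(u))` to `U`, which gains one derivative for `S`.

At a critical point, put `B = d²L(c)`. Differentiating `dL(u + w(u)) v = 0` shows that the graph of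
`D = dw(u)` is the `B`-orthogonal complement of `Uᗮ`, and `d²S(u)` is `B` on this graph. Since `B` is
positive on `Uᗮ`, index and nullity are carried by the graph (`index_eq_of_graph`,
`nullity_eq_of_graph`).

The space `H¹₀` is complete because `c ↦ ċ` is an isometry onto the functions of mean zero in `L²`,
and `L` is `C²` by differentiation under the integral, as evaluation at `t` is a bounded operator that
depends continuously on `t` in the operator norm.
-/

namespace Reduction

universe u

/-! ### Lyapunov–Schmidt reduction in a Hilbert space -/

section Reduce

variable {H : Type*} [NormedAddCommGroup H] [InnerProductSpace ℝ H] [CompleteSpace H]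

/-- If `P` is idempotent and the compression `P M P` is a strict contraction, then `1 - P M` is
invertible: the two factors below are a unipotent element and a Neumann series. -/
theorem isUnit_one_sub_mul_of_norm_lt {R : Type*} [NormedRing R] [CompleteSpace R] {P M : R}
    (hP : P * P = P) (h : ‖P * M * P‖ < 1) : IsUnit (1 - P * M) := by
  have h1 : IsUnit (1 - P * M * (1 - P)) := by
    have hz : (P * M * (1 - P)) * (P * M * (1 - P)) = 0 := by
      have : (1 - P) * P = 0 := by rw [sub_mul, one_mul, hP, sub_self]
      calc _ = P * M * ((1 - P) * P) * M * (1 - P) := by noncomm_ring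
        _ = 0 := by rw [this]; simp
    refine ⟨⟨1 - P * M * (1 - P), 1 + P * M * (1 - P), ?_, ?_⟩, rfl⟩
    · rw [sub_mul, one_mul, mul_add, mul_one, hz]; abel
    · rw [mul_sub, mul_one, add_mul, one_mul, hz]; abel
  have h2 : IsUnit (1 - P * M * P) := isUnit_one_sub_of_norm_lt_one h
  have : 1 - P * M = (1 - P * M * (1 - P)) * (1 - P * M * P) := by
    have hz : (1 - P) * P = 0 := by rw [sub_mul, one_mul, hP, sub_self]
    calc 1 - P * M = 1 - P * M * (1 - P) - P * M * P + P * M * ((1 - P) * P) * M * P := by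
          rw [hz]; noncomm_ring
      _ = _ := by noncomm_ring
  rw [this]
  exact h1.mul h2

/-- The Riesz isomorphism as a continuous linear map over `ℝ`; `InnerProductSpace.toDual` is only
conjugate-linear by type. -/
noncomputable def riesz (H : Type*) [NormedAddCommGroup H] [InnerProductSpace ℝ H]
    [CompleteSpace H] : (H →L[ℝ] ℝ) →L[ℝ] H :=
  LinearMap.mkContinuous
    { toFun := fun l => (InnerProductSpace.toDual ℝ H).symm l
      map_add' := fun a b => map_add _ a b
      map_smul' := fun a b => by simp } 1 (fun l => by simp)

theorem inner_riesz (l : H →L[ℝ] ℝ) (x : H) : inner ℝ (riesz H l) x = l x :=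
  InnerProductSpace.toDual_symm_apply

variable {U : Submodule ℝ H} [FiniteDimensional ℝ U] {L : H → ℝ} {κ : ℝ}

theorem starProjection_riesz_eq_zero_iff (l : H →L[ℝ] ℝ) :
    Uᗮ.starProjection (riesz H l) = 0 ↔ ∀ δ : Uᗮ, l (δ : H) = 0 := by
  constructor
  · intro h δ
    rw [← inner_riesz, ← Submodule.starProjection_eq_self_iff.2 δ.2,
      ← Submodule.inner_starProjection_left_eq_right, h, inner_zero_left]
  · intro h
    have hm : Uᗮ.starProjection (riesz H l) ∈ Uᗮ := by
      rw [Submodule.starProjection_apply]; exact Subtype.prop _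
    have h1 : l (Uᗮ.starProjection (riesz H l)) = 0 := h ⟨_, hm⟩
    rw [← inner_self_eq_zero (𝕜 := ℝ), Submodule.inner_starProjection_left_eq_right,
      Submodule.starProjection_eq_self_iff.2 hm, inner_riesz, h1]

/-- The derivative of the gradient of `L`. -/
noncomputable def gradDeriv (L : H → ℝ) (c : H) : H →L[ℝ] H := (riesz H).comp (hessian L c)

theorem hasFDerivAt_grad (hL : ContDiff ℝ 2 L) (c : H) :
    HasFDerivAt (fun x => riesz H (fderiv ℝ L x)) (gradDeriv L c) c :=
  (riesz H).hasFDerivAt.comp c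
    (((hL.fderiv_right (m := 1) le_rfl).differentiable one_ne_zero) c).hasFDerivAt

/-- The Hessian of `L` is `κ`-close to the inner product on `Uᗮ`. -/
def HessianClose (L : H → ℝ) (U : Submodule ℝ H) (κ : ℝ) : Prop :=
  ∀ c : H, ∀ v ∈ Uᗮ, ∀ v' ∈ Uᗮ, |inner ℝ v v' - hessian L c v v'| ≤ κ * ‖v‖ * ‖v'‖

/-- The derivative of the contraction `x ↦ P (P x - ∇L(u + P x))`, with `P` the projection to `Uᗮ`,
has norm at most `κ`. -/
theorem norm_compression_le (hκ : 0 ≤ κ) (hc : HessianClose L U κ) (c : H) :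
    ‖Uᗮ.starProjection * (1 - gradDeriv L c) * Uᗮ.starProjection‖ ≤ κ := by
  refine ContinuousLinearMap.opNorm_le_bound _ hκ fun h => ?_
  set x := Uᗮ.starProjection h with hx
  set y := (Uᗮ.starProjection * (1 - gradDeriv L c) * Uᗮ.starProjection) h with hy
  have hxm : x ∈ Uᗮ := by rw [hx, Submodule.starProjection_apply]; exact Subtype.prop _
  have hy' : y = Uᗮ.starProjection (x - gradDeriv L c x) := rfl
  have hym : y ∈ Uᗮ := by rw [hy', Submodule.starProjection_apply]; exact Subtype.prop _
  have h1 : ‖y‖ ^ 2 = inner ℝ x y - hessian L c x y := by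
    rw [← real_inner_self_eq_norm_sq]
    nth_rewrite 1 [hy']
    rw [Submodule.inner_starProjection_left_eq_right, Submodule.starProjection_eq_self_iff.2 hym,
      inner_sub_left, gradDeriv, ContinuousLinearMap.comp_apply, inner_riesz]
  have h2 : ‖y‖ ^ 2 ≤ κ * ‖x‖ * ‖y‖ := h1 ▸ (le_abs_self _).trans (hc c x hxm y hym)
  have h3 : ‖x‖ ≤ ‖h‖ := Submodule.norm_starProjection_apply_le _ _
  rcases (norm_nonneg y).eq_or_lt with h0 | h0
  · rw [← h0]; positivity
  · have : ‖y‖ ≤ κ * ‖x‖ := by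
      rw [sq] at h2
      exact le_of_mul_le_mul_right h2 h0
    exact this.trans (mul_le_mul_of_nonneg_left h3 hκ)

/-- For each `u` the equation `dL(u + v) = 0` on `Uᗮ` has exactly one solution `v`, by the contraction
principle. -/
theorem existsUnique_vertical_critical (hL : ContDiff ℝ 2 L) (hκ : 0 ≤ κ) (hκ1 : κ < 1)
    (hc : HessianClose L U κ) (u : U) :
    ∃! v : Uᗮ, ∀ δ : Uᗮ, fderiv ℝ L ((u : H) + (v : H)) (δ : H) = 0 := by
  -- the fixed points of `f` are the solutions, and its derivative is `P (1 - D∇L) P`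
  set P := Uᗮ.starProjection with hP
  let f : H → H := fun x => P (P x - riesz H (fderiv ℝ L (u + P x)))
  have hPm : ∀ x, P x ∈ Uᗮ := fun x => by
    rw [hP, Submodule.starProjection_apply]; exact Subtype.prop _
  have hPv : ∀ x ∈ Uᗮ, P x = x := fun x hx => Submodule.starProjection_eq_self_iff.2 hx
  have hd : ∀ x, HasFDerivAt f (P * (1 - gradDeriv L (u + P x)) * P) x := by
    intro x
    have h1 : HasFDerivAt (fun y : H => (u : H) + P y) P x := P.hasFDerivAt.const_add _
    have h2 := (hasFDerivAt_grad hL (u + P x)).comp x h1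
    exact P.hasFDerivAt.comp x (P.hasFDerivAt.sub h2)
  have hcon : ContractingWith ⟨κ, hκ⟩ f := by
    refine ⟨by exact_mod_cast hκ1, lipschitzWith_of_nnnorm_fderiv_le (𝕜 := ℝ)
      (fun x => (hd x).differentiableAt) fun x => ?_⟩
    rw [(hd x).fderiv]
    exact norm_compression_le hκ hc _
  have key : ∀ v : Uᗮ, (∀ δ : Uᗮ, fderiv ℝ L ((u : H) + (v : H)) (δ : H) = 0) ↔
      f v = v := by
    intro v
    rw [← starProjection_riesz_eq_zero_iff]
    change _ ↔ P (P v - riesz H (fderiv ℝ L (u + P v))) = v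
    rw [map_sub, hPv _ (hPm _), hPv _ v.2, sub_eq_self]
  have hfix : f hcon.fixedPoint = hcon.fixedPoint := hcon.fixedPoint_isFixedPt
  have hm : hcon.fixedPoint ∈ Uᗮ := by
    rw [← hfix]; exact hPm _
  refine ⟨⟨_, hm⟩, (key _).2 hfix, fun v hv => ?_⟩
  exact Subtype.ext (hcon.fixedPoint_unique ((key v).1 hv))

variable {w : U → Uᗮ}

/-- The solution of `dL(u + w u) = 0` on `Uᗮ` depends on `u` in a `C¹` way: near each point `w` agrees
with a local inverse given by the inverse function theorem. -/
theorem contDiff_vertical_critical (hL : ContDiff ℝ 2 L) (hκ : 0 ≤ κ) (hκ1 : κ < 1)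
    (hc : HessianClose L U κ)
    (hw : ∀ (u : U) (v : Uᗮ), (∀ δ : Uᗮ, fderiv ℝ L ((u : H) + (v : H)) (δ : H) = 0) ↔ v = w u) :
    ContDiff ℝ 1 w := by
  rw [contDiff_iff_contDiffAt]
  intro u₀
  set P := Uᗮ.starProjection with hP
  have hPm : ∀ x, P x ∈ Uᗮ := fun x => by
    rw [hP, Submodule.starProjection_apply]; exact Subtype.prop _
  have hPv : ∀ x ∈ Uᗮ, P x = x := fun x hx => Submodule.starProjection_eq_self_iff.2 hx
  have hPu : ∀ u : U, P u = 0 := fun u => by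
    rw [hP, Submodule.starProjection_apply_eq_zero_iff]
    exact Submodule.le_orthogonal_orthogonal _ u.2
  -- `Ψ (u + v) = u + P (∇L (u + v))`, so that `Ψ c = u` characterizes `c = u + w u`
  let Ψ : H → H := fun c => c - P c + P (riesz H (fderiv ℝ L c))
  have hΨc : ContDiff ℝ 1 Ψ := by
    have := hL.fderiv_right (m := 1) le_rfl
    fun_prop
  have hd : ∀ c, HasFDerivAt Ψ (1 - P * (1 - gradDeriv L c)) c := by
    intro c
    have h := ((hasFDerivAt_id (𝕜 := ℝ) c).sub P.hasFDerivAt).add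
      (P.hasFDerivAt.comp c (hasFDerivAt_grad hL c))
    refine h.congr_fderiv ?_
    rw [mul_sub, mul_one, ← sub_add]
    rfl
  have hsol : ∀ (u : U) (c : H), Ψ c = u → w u = Uᗮ.orthogonalProjectionOnto c := by
    intro u c h
    have h1 : P (Ψ c) = 0 := by rw [h, hPu]
    have h2 : P (riesz H (fderiv ℝ L c)) = 0 := by
      have : P (Ψ c) = P (riesz H (fderiv ℝ L c)) := by
        simp only [Ψ, map_add, map_sub]
        rw [hPv _ (hPm c), hPv _ (hPm _)]; abel
      rw [← this, h1]
    have h3 : (u : H) + P c = c := by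
      rw [← h]; simp only [Ψ, h2]; abel
    refine ((hw u _).1 ?_).symm
    rw [← Submodule.starProjection_apply, ← hP, h3]
    exact (starProjection_riesz_eq_zero_iff _).1 h2
  have hw0 : Ψ (u₀ + w u₀) = u₀ := by
    have h1 := (starProjection_riesz_eq_zero_iff _).2 ((hw u₀ (w u₀)).2 rfl)
    simp only [Ψ]
    rw [h1, map_add, hPu, hPv _ (w u₀).2]
    abel
  have hunit : IsUnit (1 - P * (1 - gradDeriv L ((u₀ : H) + w u₀))) := by
    refine isUnit_one_sub_mul_of_norm_lt ?_ ((norm_compression_le hκ hc _).trans_lt hκ1)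
    ext x
    exact hPv _ (hPm x)
  obtain ⟨e, he⟩ := hunit
  let e' : H ≃L[ℝ] H := ContinuousLinearEquiv.unitsEquiv ℝ H e
  have hde : HasFDerivAt Ψ (e' : H →L[ℝ] H) ((u₀ : H) + w u₀) := by
    refine (hd _).congr_fderiv ?_
    rw [← he]
    rfl
  have hat : ContDiffAt ℝ 1 Ψ ((u₀ : H) + w u₀) := hΨc.contDiffAt
  have hinv := hat.to_localInverse hde one_ne_zero
  rw [hw0] at hinv
  have hs := hat.hasStrictFDerivAt' hde one_ne_zero
  have hev := hs.eventually_right_inverse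
  rw [hw0] at hev
  have hev' : ∀ᶠ u : U in nhds u₀, w u =
      Uᗮ.orthogonalProjectionOnto (hat.localInverse hde one_ne_zero (u : H)) := by
    have ht : Filter.Tendsto (fun u : U => (u : H)) (nhds u₀) (nhds (u₀ : H)) :=
      continuous_subtype_val.continuousAt
    filter_upwards [ht.eventually hev] with u hu
    exact hsol u _ hu
  refine ContDiffAt.congr_of_eventuallyEq ?_ hev'
  have h5 : ContDiffAt ℝ 1 (fun u : U => hat.localInverse hde one_ne_zero (u : H)) u₀ :=
    ContDiffAt.comp u₀ hinv (U.subtypeL.contDiff.contDiffAt)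
  exact (Uᗮ.orthogonalProjectionOnto).contDiff.contDiffAt.comp u₀ h5

end Reduce

section Reduced

variable {H : Type*} [NormedAddCommGroup H] [InnerProductSpace ℝ H] {U : Submodule ℝ H}
  {L : H → ℝ} {w : U → Uᗮ}

/-- The term with the derivative of `w` drops out, since `dL(u + w u)` vanishes on `Uᗮ`. The formula
involves only `w`, not its derivative, which is why the reduced functional is `C²`. -/
theorem hasFDerivAt_reduced (hL : ContDiff ℝ 2 L) (hwc : ContDiff ℝ 1 w)
    (hw : ∀ (u : U) (v : Uᗮ), (∀ δ : Uᗮ, fderiv ℝ L ((u : H) + (v : H)) (δ : H) = 0) ↔ v = w u)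
    (u : U) :
    HasFDerivAt (fun u : U => L ((u : H) + w u))
      ((fderiv ℝ L ((u : H) + w u)).comp U.subtypeL) u := by
  have h1 : HasFDerivAt (fun u : U => (u : H) + w u)
      (U.subtypeL + Uᗮ.subtypeL.comp (fderiv ℝ w u)) u :=
    U.subtypeL.hasFDerivAt.add
      (Uᗮ.subtypeL.hasFDerivAt.comp u ((hwc.differentiable one_ne_zero) u).hasFDerivAt)
  have h2 := ((hL.differentiable two_ne_zero) ((u : H) + w u)).hasFDerivAt.comp u h1
  refine h2.congr_fderiv ?_
  ext a
  have := (hw u (w u)).2 rfl (fderiv ℝ w u a)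
  simp [this]

theorem contDiff_fderiv_lift (hL : ContDiff ℝ 2 L) (hwc : ContDiff ℝ 1 w) :
    ContDiff ℝ 1 fun u : U => fderiv ℝ L ((u : H) + w u) :=
  (hL.fderiv_right (m := 1) le_rfl).comp
    (U.subtypeL.contDiff.add (Uᗮ.subtypeL.contDiff.comp hwc))

theorem contDiff_two_reduced (hL : ContDiff ℝ 2 L) (hwc : ContDiff ℝ 1 w)
    (hw : ∀ (u : U) (v : Uᗮ), (∀ δ : Uᗮ, fderiv ℝ L ((u : H) + (v : H)) (δ : H) = 0) ↔ v = w u) :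
    ContDiff ℝ 2 fun u : U => L ((u : H) + w u) := by
  refine (contDiff_succ_iff_hasFDerivAt (n := 1)).2 ⟨_, ?_, hasFDerivAt_reduced hL hwc hw⟩
  exact (contDiff_fderiv_lift hL hwc).clm_comp contDiff_const

theorem fderiv_reduced_eq_zero_iff [U.HasOrthogonalProjection] (hL : ContDiff ℝ 2 L)
    (hwc : ContDiff ℝ 1 w)
    (hw : ∀ (u : U) (v : Uᗮ), (∀ δ : Uᗮ, fderiv ℝ L ((u : H) + (v : H)) (δ : H) = 0) ↔ v = w u)
    (u : U) :
    fderiv ℝ (fun u : U => L ((u : H) + w u)) u = 0 ↔ fderiv ℝ L ((u : H) + w u) = 0 := by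
  rw [(hasFDerivAt_reduced hL hwc hw u).fderiv]
  constructor
  · intro h
    ext x
    obtain ⟨a, ha, b, hb, rfl⟩ := U.exists_add_mem_mem_orthogonal x
    have h1 := DFunLike.congr_fun h ⟨a, ha⟩
    have h2 := (hw u (w u)).2 rfl ⟨b, hb⟩
    simp only [ContinuousLinearMap.comp_apply, Submodule.subtypeL_apply,
      zero_apply] at h1
    rw [map_add, h1, h2]
    simp
  · intro h
    rw [h, ContinuousLinearMap.zero_comp]

/-- The graph of the derivative of `w` is orthogonal to `Uᗮ` for the Hessian of `L`, and the Hessian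
of the reduced functional is the Hessian of `L` restricted to that graph. -/
theorem hessian_lift (hL : ContDiff ℝ 2 L) (hwc : ContDiff ℝ 1 w)
    (hw : ∀ (u : U) (v : Uᗮ), (∀ δ : Uᗮ, fderiv ℝ L ((u : H) + (v : H)) (δ : H) = 0) ↔ v = w u)
    (u a : U) :
    (∀ v ∈ Uᗮ, hessian L ((u : H) + w u) ((a : H) + fderiv ℝ w u a) v = 0) ∧
    ∀ b : U, hessian (fun u : U => L ((u : H) + w u)) u a b =
      hessian L ((u : H) + w u) ((a : H) + fderiv ℝ w u a) b := by
  have h1 : HasFDerivAt (fun u : U => (u : H) + w u)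
      (U.subtypeL + Uᗮ.subtypeL.comp (fderiv ℝ w u)) u :=
    U.subtypeL.hasFDerivAt.add
      (Uᗮ.subtypeL.hasFDerivAt.comp u ((hwc.differentiable one_ne_zero) u).hasFDerivAt)
  have h2 : HasFDerivAt (fun u : U => fderiv ℝ L ((u : H) + w u))
      ((hessian L ((u : H) + w u)).comp (U.subtypeL + Uᗮ.subtypeL.comp (fderiv ℝ w u))) u :=
    (((hL.fderiv_right (m := 1) le_rfl).differentiable one_ne_zero)
      ((u : H) + w u)).hasFDerivAt.comp u h1
  constructor
  · intro v hv
    have h3 := h2.clm_apply (hasFDerivAt_const v u)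
    have h4 : (fun u : U => fderiv ℝ L ((u : H) + w u) v) = fun _ => 0 := by
      funext u'
      exact (hw u' (w u')).2 rfl ⟨v, hv⟩
    rw [h4] at h3
    have h5 := DFunLike.congr_fun (h3.unique (hasFDerivAt_const (0 : ℝ) u)) a
    simpa using h5
  · intro b
    have h6 : fderiv ℝ (fun u : U => L ((u : H) + w u)) =
        fun u : U => (fderiv ℝ L ((u : H) + w u)).comp U.subtypeL :=
      funext fun u : U => (hasFDerivAt_reduced hL hwc hw u).fderiv
    have h7 := h2.clm_comp (hasFDerivAt_const U.subtypeL u)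
    rw [hessian, h6, h7.fderiv]
    simp

end Reduced

/-! ### Index and nullity of a bilinear form and of its reduction -/

/-- A linear map carrying negative vectors to negative vectors is injective on every negative
subspace. -/
theorem index_le_index {E F : Type u} [NormedAddCommGroup E] [NormedSpace ℝ E]
    [NormedAddCommGroup F] [NormedSpace ℝ F] {B : E →L[ℝ] E →L[ℝ] ℝ} {S : F →L[ℝ] F →L[ℝ] ℝ}
    (f : E →ₗ[ℝ] F) (h : ∀ x, B x x < 0 → S (f x) (f x) < 0) : index B ≤ index S := by
  refine iSup_le fun ⟨W, hW⟩ => ?_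
  have hne : ∀ x ∈ W, x ≠ 0 → S (f x) (f x) < 0 := fun x hx hx0 => h x (hW x hx hx0)
  have hinj : Function.Injective (f.domRestrict W) := by
    rw [injective_iff_map_eq_zero]
    intro x hx
    by_contra hx0
    have h1 := hne x x.2 (fun h => hx0 (Subtype.ext h))
    have h2 : f x = 0 := hx
    simp [h2] at h1
  have hneg : IsNegative S (LinearMap.range (f.domRestrict W)) := by
    rintro _ ⟨x, rfl⟩ hx0
    refine hne x x.2 fun h => hx0 ?_
    rw [LinearMap.domRestrict_apply, h, map_zero]
  have hr := (LinearEquiv.ofInjective _ hinj).rank_eq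
  dsimp only
  rw [hr]
  exact le_iSup (fun W : {W : Submodule ℝ F // IsNegative S W} =>
    Cardinal.toENat (Module.rank ℝ W.1)) ⟨_, hneg⟩

theorem index_le_of_rank_le {E : Type*} [NormedAddCommGroup E] [NormedSpace ℝ E]
    (B : E →L[ℝ] E →L[ℝ] ℝ) {m : ℕ} (h : Module.rank ℝ E ≤ m) : index B ≤ m := by
  refine iSup_le fun W => ?_
  have := Cardinal.toENat.monotone' ((Submodule.rank_le W.1).trans h)
  simpa using this

section Schur

variable {H : Type*} [NormedAddCommGroup H] [InnerProductSpace ℝ H] {U : Submodule ℝ H}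
  {B : H →L[ℝ] H →L[ℝ] ℝ} {S : U →L[ℝ] U →L[ℝ] ℝ} {D : U →L[ℝ] Uᗮ}

/-- The projection of `h` to `Uᗮ` along the graph of `D`. -/
theorem sub_graph_mem [U.HasOrthogonalProjection] (D : U →L[ℝ] Uᗮ) (h : H) :
    h - ((U.orthogonalProjectionOnto h : H) + D (U.orthogonalProjectionOnto h)) ∈ Uᗮ := by
  rw [← sub_sub]
  exact sub_mem (Submodule.sub_starProjection_mem_orthogonal h) (D _).2

/-- If `Uᗮ` is positive for `B` and the graph of `D` is `B`-orthogonal to it, then `B` has the index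
of its restriction `S` to the graph, written in the coordinates of `U`. -/
theorem index_eq_of_graph [U.HasOrthogonalProjection] (hsymm : ∀ x y, B x y = B y x)
    (hpos : ∀ v ∈ Uᗮ, v ≠ 0 → 0 < B v v)
    (hD : ∀ a : U, ∀ v ∈ Uᗮ, B ((a : H) + D a) v = 0)
    (hS : ∀ a b : U, S a b = B ((a : H) + D a) b) : index B = index S := by
  apply le_antisymm
  · refine index_le_index (U.orthogonalProjectionOnto : H →ₗ[ℝ] U) fun h hh => ?_
    change S (U.orthogonalProjectionOnto h) (U.orthogonalProjectionOnto h) < 0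
    set a := U.orthogonalProjectionOnto h
    set v := h - ((a : H) + D a) with hv
    have hvm : v ∈ Uᗮ := sub_graph_mem D h
    have hv0 : 0 ≤ B v v := by
      by_cases h0 : v = 0
      · simp [h0]
      · exact (hpos v hvm h0).le
    have hh' : h = ((a : H) + D a) + v := by rw [hv]; abel
    have h1 : B h h = S a a + B v v := by
      rw [hh', map_add (B _), map_add B, add_apply, add_apply, hD a v hvm, hsymm v, hD a v hvm,
        map_add (B _) (a : H), hD a _ (D a).2, hS]
      ring
    linarith
  · refine index_le_index (U.subtype + Uᗮ.subtype.comp (D : U →ₗ[ℝ] Uᗮ)) fun a ha => ?_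
    change B ((a : H) + D a) ((a : H) + D a) < 0
    rw [map_add (B _) (a : H), hD a _ (D a).2, ← hS, add_zero]
    exact ha

/-- Under the same hypotheses the kernel of `B` lies in the graph of `D`, and the projection to `U`
identifies it with the kernel of `S`. -/
theorem nullity_eq_of_graph [U.HasOrthogonalProjection]
    (hpos : ∀ v ∈ Uᗮ, v ≠ 0 → 0 < B v v)
    (hD : ∀ a : U, ∀ v ∈ Uᗮ, B ((a : H) + D a) v = 0)
    (hS : ∀ a b : U, S a b = B ((a : H) + D a) b) : nullity B = nullity S := by
  have hker : ∀ h : H, B h = 0 → h = (U.orthogonalProjectionOnto h : H) +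
      D (U.orthogonalProjectionOnto h) := by
    intro h hh
    have hvm := sub_graph_mem D h
    set a := U.orthogonalProjectionOnto h
    set v := h - ((a : H) + D a) with hv
    by_contra hne
    have h1 := hpos v hvm (by rw [hv]; exact sub_ne_zero.2 hne)
    have h2 : B v v = B h v - B ((a : H) + D a) v := by
      rw [← sub_apply, ← map_sub]
    rw [hh, hD a v hvm] at h2
    simp only [zero_apply, sub_zero] at h2
    exact h1.ne' h2
  apply le_antisymm
  · refine Cardinal.toENat.monotone' ?_
    have hmem : ∀ h : LinearMap.ker (B : H →ₗ[ℝ] H →L[ℝ] ℝ), U.orthogonalProjectionOnto (h : H) ∈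
        LinearMap.ker (S : U →ₗ[ℝ] U →L[ℝ] ℝ) := by
      rintro ⟨h, hh⟩
      have hh' : B h = 0 := hh
      change S _ = 0
      ext b
      rw [hS, ← hker h hh', hh']
      rfl
    refine LinearMap.rank_le_of_injective
      (((U.orthogonalProjectionOnto : H →ₗ[ℝ] U).domRestrict _).codRestrict _ hmem) ?_
    rintro ⟨h, hh⟩ ⟨k, hk⟩ hhk
    have e : U.orthogonalProjectionOnto h = U.orthogonalProjectionOnto k := congrArg Subtype.val hhk
    apply Subtype.ext
    change h = k
    rw [hker h hh, hker k hk, e]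
  · refine Cardinal.toENat.monotone' ?_
    have hmem : ∀ a : LinearMap.ker (S : U →ₗ[ℝ] U →L[ℝ] ℝ), (a : H) + D a ∈
        LinearMap.ker (B : H →ₗ[ℝ] H →L[ℝ] ℝ) := by
      rintro ⟨a, ha⟩
      have ha' : S a = 0 := ha
      change B ((a : H) + D a) = 0
      ext x
      obtain ⟨b, hb, v, hv, rfl⟩ := U.exists_add_mem_mem_orthogonal x
      rw [map_add, hD a v hv, add_zero, ← hS a ⟨b, hb⟩, ha']
      rfl
    refine LinearMap.rank_le_of_injective
      (((U.subtype + Uᗮ.subtype.comp (D : U →ₗ[ℝ] Uᗮ)).domRestrict _).codRestrict _ hmem) ?_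
    rintro ⟨a, ha⟩ ⟨b, hb⟩ hab
    have e : (a : H) + D a = b + D b := congrArg Subtype.val hab
    have e' := congrArg U.orthogonalProjectionOnto e
    apply Subtype.ext
    change a = b
    have hz : ∀ v : Uᗮ, U.orthogonalProjectionOnto (v : H) = 0 := fun v =>
      (Submodule.orthogonalProjectionOnto_eq_zero_iff).2 v.2
    simpa [hz] using e'

end Schur

/-! ### Curves of class `H¹`: evaluation maps and completeness -/

theorem absolutelyContinuous_of_dist_le {X Y : Type*} [PseudoMetricSpace X] [PseudoMetricSpace Y]
    {f : ℝ → X} {g : ℝ → Y} {a b K : ℝ} (hf : AbsolutelyContinuousOnInterval f a b)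
    (h : ∀ x ∈ uIcc a b, ∀ y ∈ uIcc a b, dist (g x) (g y) ≤ K * dist (f x) (f y)) :
    AbsolutelyContinuousOnInterval g a b := by
  have h0 : Filter.Tendsto (fun E : ℕ × (ℕ → ℝ × ℝ) =>
      K * ∑ i ∈ Finset.range E.1, dist (f (E.2 i).1) (f (E.2 i).2))
      (AbsolutelyContinuousOnInterval.totalLengthFilter ⊓
        Filter.principal (AbsolutelyContinuousOnInterval.disjWithin a b)) (nhds 0) := by
    simpa using Filter.Tendsto.const_mul K hf
  refine squeeze_zero' (Filter.Eventually.of_forall fun E =>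
    Finset.sum_nonneg fun _ _ => dist_nonneg) ?_ h0
  refine Filter.eventually_inf_principal.2 (Filter.Eventually.of_forall fun E hE => ?_)
  rw [Finset.mul_sum]
  exact Finset.sum_le_sum fun i hi => h _ (hE.1 i hi).1 _ (hE.1 i hi).2

theorem absolutelyContinuous_inner {n : ℕ} {c : ℝ → Conf n} {a b : ℝ}
    (hc : AbsolutelyContinuousOnInterval c a b) (e : Conf n) :
    AbsolutelyContinuousOnInterval (fun t => inner ℝ e (c t)) a b := by
  refine absolutelyContinuous_of_dist_le (K := ‖e‖) hc fun x _ y _ => ?_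
  rw [Real.dist_eq, ← inner_sub_right, dist_eq_norm]
  exact abs_real_inner_le_norm _ _

variable {n : ℕ} {T : ℝ}

theorem H10.inner_def (c d : H10 n T) :
    inner ℝ c d = ∫ t in Ioo 0 T, inner ℝ (deriv c.curve t) (deriv d.curve t) := rfl

theorem H10.absolutelyContinuous (c : H10 n T) : AbsolutelyContinuousOnInterval c.curve 0 T :=
  c.2.1

theorem H10.memLp_deriv (c : H10 n T) :
    MemLp (deriv c.curve) 2 (volume.restrict (Ioo 0 T)) := c.2.2.1

theorem H10.curve_eq_zero (c : H10 n T) {t : ℝ} (ht : t ∉ Ioo 0 T) : c.curve t = 0 := c.2.2.2 t ht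

theorem H10.ae_differentiableAt (c : H10 n T) :
    ∀ᵐ t ∂(volume.restrict (Ioo 0 T)), DifferentiableAt ℝ c.curve t :=
  Reduction.ae_differentiableAt c.2.1

/-- The isometry `c ↦ ċ` from `H¹₀` to `L²`. -/
noncomputable def derivIsometry (n : ℕ) (T : ℝ) :
    H10 n T →ₗᵢ[ℝ] Lp (Conf n) 2 (volume.restrict (Ioo 0 T)) :=
  LinearMap.isometryOfInner
    { toFun := fun c => c.memLp_deriv.toLp
      map_add' := fun c d => by
        rw [← MemLp.toLp_add c.memLp_deriv d.memLp_deriv]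
        exact (MemLp.toLp_eq_toLp_iff _ _).2 (deriv_add_ae c.2.1 d.2.1)
      map_smul' := fun a c => by
        rw [RingHom.id_apply, ← MemLp.toLp_const_smul a c.memLp_deriv]
        exact (MemLp.toLp_eq_toLp_iff _ _).2 (deriv_const_smul_ae a c.2.1) }
    (fun c d => by
      rw [H10.inner_def, L2.inner_def]
      refine integral_congr_ae ?_
      filter_upwards [c.memLp_deriv.coeFn_toLp, d.memLp_deriv.coeFn_toLp] with t h1 h2
      simp only [LinearMap.coe_mk, AddHom.coe_mk]
      rw [h1, h2])

theorem derivIsometry_ae (c : H10 n T) :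
    derivIsometry n T c =ᵐ[volume.restrict (Ioo 0 T)] deriv c.curve := c.memLp_deriv.coeFn_toLp

theorem H10.integrable_deriv (c : H10 n T) :
    Integrable (deriv c.curve) (volume.restrict (Ioo 0 T)) := c.memLp_deriv.integrable one_le_two

theorem H10.inner_sub_eq_integral (c : H10 n T) (e : Conf n) {s t : ℝ} (hs : 0 ≤ s) (hst : s ≤ t)
    (ht : t ≤ T) :
    inner ℝ e (c.curve t - c.curve s) = ∫ x in Ioc s t, inner ℝ e (deriv c.curve x) := by
  have hac : AbsolutelyContinuousOnInterval (fun t => inner ℝ e (c.curve t)) s t := by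
    refine (absolutelyContinuous_inner c.absolutelyContinuous e).mono ?_
    rw [uIcc_of_le hst, uIcc_of_le (hs.trans (hst.trans ht))]
    exact Icc_subset_Icc hs ht
  have h := hac.integral_deriv_eq_sub
  rw [inner_sub_right, ← h, intervalIntegral.integral_of_le hst, integral_Ioc_eq_integral_Ioo,
    integral_Ioc_eq_integral_Ioo]
  refine integral_congr_ae ?_
  have h2 := ae_restrict_of_ae_restrict_of_subset (Ioo_subset_Ioo hs ht) c.ae_differentiableAt
  filter_upwards [h2] with x hx
  have h3 := (hasDerivAt_const x e).inner ℝ hx.hasDerivAt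
  simpa using h3.deriv

/-- Curves of class `H¹` are Hölder continuous with exponent `1/2`. -/
theorem H10.norm_sub_le (c : H10 n T) {s t : ℝ} (hs : 0 ≤ s) (hst : s ≤ t) (ht : t ≤ T) :
    ‖c.curve t - c.curve s‖ ≤ √(t - s) * ‖c‖ := by
  set e := c.curve t - c.curve s with he
  have hμ : (volume.restrict (Ioo 0 T)) (Ioo s t) ≠ ⊤ :=
    ((Measure.restrict_apply_le _ _).trans_lt (by simp)).ne
  have h1 : inner ℝ (indicatorConstLp 2 measurableSet_Ioo hμ e) (derivIsometry n T c) =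
      ‖e‖ ^ 2 := by
    rw [L2.inner_indicatorConstLp_eq_setIntegral_inner, ← real_inner_self_eq_norm_sq,
      Measure.restrict_restrict_of_subset (Ioo_subset_Ioo hs ht)]
    nth_rewrite 3 [he]
    rw [c.inner_sub_eq_integral e hs hst ht, integral_Ioc_eq_integral_Ioo]
    refine integral_congr_ae ?_
    filter_upwards [ae_restrict_of_ae_restrict_of_subset (Ioo_subset_Ioo hs ht)
      (derivIsometry_ae c)] with x hx
    rw [hx]
  have h2 : ‖indicatorConstLp 2 measurableSet_Ioo hμ e‖ = ‖e‖ * √(t - s) := by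
    rw [norm_indicatorConstLp two_ne_zero ENNReal.ofNat_ne_top, Measure.real,
      Measure.restrict_apply measurableSet_Ioo,
      inter_eq_left.2 (Ioo_subset_Ioo hs ht), Real.volume_Ioo,
      ENNReal.toReal_ofReal (sub_nonneg.2 hst), Real.sqrt_eq_rpow]
    simp
  have h3 := real_inner_le_norm (indicatorConstLp 2 measurableSet_Ioo hμ e) (derivIsometry n T c)
  rw [h1, h2, LinearIsometry.norm_map] at h3
  rcases (norm_nonneg e).eq_or_lt with h0 | h0
  · rw [← h0]; positivity
  · refine le_of_mul_le_mul_left ?_ h0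
    calc ‖e‖ * ‖e‖ = ‖e‖ ^ 2 := by ring
      _ ≤ ‖e‖ * √(t - s) * ‖c‖ := h3
      _ = _ := by ring

theorem H10.curve_zero (c : H10 n T) : c.curve 0 = 0 := c.curve_eq_zero (by simp)

theorem H10.curve_end (c : H10 n T) : c.curve T = 0 := c.curve_eq_zero (by simp)

/-- Curves vanish outside `(0, T)`, so bounds on `[0, T]` extend to all times. -/
theorem H10.curve_clamp (c : H10 n T) (hT : 0 ≤ T) (t : ℝ) :
    c.curve (max 0 (min T t)) = c.curve t := by
  rcases le_total t 0 with h | h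
  · rw [min_eq_right (h.trans hT), max_eq_left h, c.curve_zero,
      c.curve_eq_zero (fun h' => absurd h'.1 (not_lt.2 h))]
  · rcases le_total T t with h' | h'
    · rw [min_eq_left h', max_eq_right hT, c.curve_end,
        c.curve_eq_zero (fun h'' => absurd h''.2 (not_lt.2 h'))]
    · rw [min_eq_right h', max_eq_right h]

theorem H10.norm_sub_le_abs (hT : 0 ≤ T) (c : H10 n T) (s t : ℝ) :
    ‖c.curve t - c.curve s‖ ≤ √|t - s| * ‖c‖ := by
  wlog hst : s ≤ t generalizing s t
  · rw [norm_sub_rev, abs_sub_comm]; exact this t s (le_of_not_ge hst)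
  rw [← c.curve_clamp hT t, ← c.curve_clamp hT s]
  refine (c.norm_sub_le (le_max_left _ _) (max_le_max le_rfl (min_le_min le_rfl hst))
    (max_le hT (min_le_left _ _))).trans ?_
  refine mul_le_mul_of_nonneg_right (Real.sqrt_le_sqrt ?_) (norm_nonneg _)
  rw [abs_of_nonneg (sub_nonneg.2 hst)]
  grind

/-- Evaluation at time `t`, a bounded operator by the embedding of `H¹` in `C⁰`. -/
noncomputable def evalL (hT : 0 ≤ T) (t : ℝ) : H10 n T →L[ℝ] Conf n :=
  LinearMap.mkContinuous
    { toFun := fun c => c.curve t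
      map_add' := fun _ _ => rfl
      map_smul' := fun _ _ => rfl } (√|t|) (fun c => by
      have := c.norm_sub_le_abs hT 0 t
      rw [c.curve_zero, sub_zero, sub_zero] at this
      exact this)

theorem continuous_evalL (hT : 0 ≤ T) : Continuous fun t => (evalL hT t : H10 n T →L[ℝ] Conf n) := by
  rw [continuous_iff_continuousAt]
  intro s
  refine (tendsto_iff_norm_sub_tendsto_zero (E := H10 n T →L[ℝ] Conf n)).2 ?_
  have h0 : Filter.Tendsto (fun t : ℝ => √|t - s|) (nhds s) (nhds 0) := by
    have : Continuous fun t : ℝ => √|t - s| := by fun_prop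
    simpa using this.tendsto s
  refine squeeze_zero (fun _ => ContinuousLinearMap.opNorm_nonneg _) (fun t => ?_) h0
  exact ContinuousLinearMap.opNorm_le_bound _ (Real.sqrt_nonneg _) fun c => c.norm_sub_le_abs hT s t

theorem H10.continuous_curve (hT : 0 ≤ T) (c : H10 n T) : Continuous c.curve :=
  (continuous_evalL hT).clm_apply continuous_const

/-- An `L²` function of mean zero is the derivative of its primitive, which lies in `H¹₀`. -/
theorem exists_derivIsometry_eq (hT : 0 ≤ T) (f : Lp (Conf n) 2 (volume.restrict (Ioo 0 T)))
    (hf : ∫ t in Ioo 0 T, f t = 0) : ∃ c : H10 n T, derivIsometry n T c = f := by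
  have hfi : Integrable f (volume.restrict (Ioo 0 T)) := (Lp.memLp f).integrable one_le_two
  have hfi' : IntervalIntegrable f volume 0 T :=
    (intervalIntegrable_iff_integrableOn_Ioo_of_le hT).2 hfi
  have hsub : ∀ s ∈ uIcc 0 T, ∀ t ∈ uIcc 0 T, IntervalIntegrable f volume s t := fun s hs t ht =>
    hfi'.mono_set (uIcc_subset_uIcc hs ht)
  set g : ℝ → Conf n := fun t => ∫ x in (0 : ℝ)..t, f x with hg
  have hgac : AbsolutelyContinuousOnInterval g 0 T := by
    refine absolutelyContinuous_of_dist_le (K := 1)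
      (hfi'.norm.absolutelyContinuousOnInterval_intervalIntegral (c := 0) left_mem_uIcc) ?_
    intro s hs t ht
    rw [one_mul, dist_comm (g s), dist_comm (∫ v in (0 : ℝ)..s, ‖f v‖), dist_eq_norm, Real.dist_eq,
      intervalIntegral.integral_interval_sub_left (hsub _ left_mem_uIcc _ ht)
        (hsub _ left_mem_uIcc _ hs),
      intervalIntegral.integral_interval_sub_left (hsub _ left_mem_uIcc _ ht).norm
        (hsub _ left_mem_uIcc _ hs).norm]
    exact intervalIntegral.norm_integral_le_abs_integral_norm
  have hg0 : g 0 = 0 := intervalIntegral.integral_same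
  have hgT : g T = 0 := by
    rw [hg]
    dsimp only
    rw [intervalIntegral.integral_of_le hT, integral_Ioc_eq_integral_Ioo, hf]
  set c : ℝ → Conf n := (Ioo 0 T).indicator g with hc
  have hcg : ∀ t ∈ uIcc 0 T, c t = g t := by
    intro t ht
    rw [uIcc_of_le hT] at ht
    by_cases h : t ∈ Ioo 0 T
    · exact indicator_of_mem h _
    · rw [hc, indicator_of_notMem h]
      rcases eq_or_lt_of_le ht.1 with h1 | h1
      · rw [← h1, hg0]
      · rcases eq_or_lt_of_le ht.2 with h2 | h2
        · rw [h2, hgT]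
        · exact absurd ⟨h1, h2⟩ h
  have hcac : AbsolutelyContinuousOnInterval c 0 T :=
    absolutelyContinuous_of_dist_le (K := 1) hgac fun s hs t ht => by
      rw [hcg s hs, hcg t ht, one_mul]
  have hd : deriv c =ᵐ[volume.restrict (Ioo 0 T)] f := by
    rw [Filter.EventuallyEq, ae_restrict_iff' measurableSet_Ioo]
    filter_upwards [hfi'.ae_hasDerivAt_integral] with t ht htm
    have htm' : t ∈ uIcc 0 T := by rw [uIcc_of_le hT]; exact Ioo_subset_Icc_self htm
    have h1 := ht htm' 0 left_mem_uIcc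
    rw [← h1.deriv]
    refine Filter.EventuallyEq.deriv_eq ?_
    filter_upwards [isOpen_Ioo.mem_nhds htm] with s hs
    exact indicator_of_mem hs _
  refine ⟨⟨c, hcac, (memLp_congr_ae hd).2 (Lp.memLp f), fun t ht => indicator_of_notMem ht _⟩, ?_⟩
  exact Lp.ext ((derivIsometry_ae _).trans hd)

theorem H10.integral_deriv_eq_zero (hT : 0 ≤ T) (c : H10 n T) :
    ∫ t in Ioo 0 T, deriv c.curve t = 0 := by
  refine ext_inner_left ℝ fun e => ?_
  have h := c.inner_sub_eq_integral e le_rfl hT le_rfl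
  rw [c.curve_zero, c.curve_end, integral_Ioc_eq_integral_Ioo] at h
  rw [← integral_inner c.integrable_deriv, ← h, sub_zero]

/-- The image of `c ↦ ċ` in `L²` is the closed subspace of functions orthogonal to the constants. -/
theorem completeSpace_H10 (hT : 0 ≤ T) : CompleteSpace (H10 n T) := by
  have hr : range (derivIsometry n T) = {f | ∀ e : Conf n, inner ℝ (indicatorConstLp 2
      (μ := volume.restrict (Ioo 0 T)) MeasurableSet.univ (measure_ne_top _ _) e) f = 0} := by
    have key : ∀ (f : Lp (Conf n) 2 (volume.restrict (Ioo 0 T))) (e : Conf n),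
        inner ℝ (indicatorConstLp 2
          (μ := volume.restrict (Ioo 0 T)) MeasurableSet.univ (measure_ne_top _ _) e) f =
        inner ℝ e (∫ t in Ioo 0 T, f t) := by
      intro f e
      rw [L2.inner_indicatorConstLp_eq_setIntegral_inner, Measure.restrict_univ,
        integral_inner ((Lp.memLp f).integrable one_le_two)]
    ext f
    simp only [mem_range, Set.mem_ofPred_eq, key]
    constructor
    · rintro ⟨c, rfl⟩ e
      rw [integral_congr_ae (derivIsometry_ae c), c.integral_deriv_eq_zero hT, inner_zero_right]
    · intro h
      exact exists_derivIsometry_eq hT f (ext_inner_left ℝ fun e => by rw [h e, inner_zero_right])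
  have hcl : IsClosed (range (derivIsometry n T)) := by
    rw [hr, Set.ofPred_forall]
    exact isClosed_iInter fun e =>
      isClosed_eq (continuous_const.inner continuous_id) continuous_const
  exact (completeSpace_iff_isComplete_range (derivIsometry n T).isometry.isUniformInducing).2
    hcl.isComplete


/-! ### Wirtinger's inequality on the high modes -/

section Parseval

variable {T : ℝ} {h : ℝ → ℝ}

theorem integrable_of_memLp_of_support (h2 : MemLp h 2 volume) (hs : ∀ x ∉ Ioo 0 T, h x = 0) :
    Integrable h := by
  rw [← integrableOn_iff_integrable_of_support_subset (s := Ioo 0 T)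
    (Function.support_subset_iff'.2 hs)]
  exact (h2.restrict (Ioo 0 T)).integrable one_le_two

/-- Parseval's identity on `[-T, T]` for the even (`ε = 1`) or odd (`ε = -1`) extension of a function
on `[0, T]`. -/
theorem hasSum_sq_reflect (hT : 0 < T) (h2 : MemLp h 2 volume)
    (hs : ∀ x ∉ Ioo 0 T, h x = 0) {ε : ℝ} (hε : ε ^ 2 = 1) :
    HasSum (fun m : ℤ => ‖∫ x : ℝ, (Complex.exp (-(m * Real.pi * x / T * Complex.I)) +
      ε * Complex.exp (m * Real.pi * x / T * Complex.I)) * (h x : ℂ)‖ ^ 2)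
      (4 * T * ∫ x, h x ^ 2) := by
  have hi := integrable_of_memLp_of_support h2 hs
  have hab : -T < T := by linarith
  set F : ℝ → ℂ := fun x => (h x : ℂ) + ε * (h (-x) : ℂ) with hF
  have h2n : MemLp (fun x => h (-x)) 2 volume :=
    h2.comp_measurePreserving (Measure.measurePreserving_neg volume)
  have h2c : MemLp (fun x => (h x : ℂ)) 2 volume := h2.ofReal
  have h2nc : MemLp (fun x => (h (-x) : ℂ)) 2 volume := h2n.ofReal
  have hF2 : MemLp F 2 volume := h2c.add (h2nc.const_mul (ε : ℂ))
  have hF0 : ∀ x ∉ Ioc (-T) T, F x = 0 := by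
    intro x hx
    have h1 : h x = 0 := hs x fun hx' => hx ⟨by linarith [hx'.1], hx'.2.le⟩
    have h3 : h (-x) = 0 := hs (-x) fun hx' => hx ⟨by linarith [hx'.2], by linarith [hx'.1]⟩
    simp [hF, h1, h3]
  have hP := hasSum_sq_fourierCoeffOn hab (hF2.restrict (Ioc (-T) T))
  have hcoef : ∀ m : ℤ, fourierCoeffOn hab F m = (1 / (2 * T) : ℝ) •
      ∫ x : ℝ, (Complex.exp (-(m * Real.pi * x / T * Complex.I)) +
        ε * Complex.exp (m * Real.pi * x / T * Complex.I)) * (h x : ℂ) := by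
    intro m
    have hexp : ∀ (σ : ℝ), Integrable (fun x : ℝ =>
        Complex.exp (σ * (m * Real.pi * x / T) * Complex.I) * (h x : ℂ)) := by
      intro σ
      have hic : Integrable (fun x => (h x : ℂ)) := hi.ofReal
      refine hic.bdd_mul (c := 1) (Continuous.aestronglyMeasurable (by fun_prop)) ?_
      refine Filter.Eventually.of_forall fun x => ?_
      have : (σ * (m * Real.pi * x / T) * Complex.I : ℂ) =
        ((σ * (m * Real.pi * x / T) : ℝ) : ℂ) * Complex.I := by push_cast; ring
      rw [this, Complex.norm_exp_ofReal_mul_I]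
    have hp := hexp 1
    have hm := hexp (-1)
    simp only [Complex.ofReal_one, one_mul, Complex.ofReal_neg, neg_mul] at hp hm
    have hmn : Integrable (fun x : ℝ =>
        Complex.exp (-(m * Real.pi * x / T * Complex.I)) * (h (-x) : ℂ)) := by
      have := hp.comp_neg
      refine this.congr (Filter.Eventually.of_forall fun x => ?_)
      dsimp only
      congr 2
      push_cast; ring
    rw [fourierCoeffOn_eq_integral, intervalIntegral.integral_of_le hab.le,
      setIntegral_eq_integral_of_forall_compl_eq_zero (fun x hx => by rw [hF0 x hx, smul_zero])]
    refine congr_arg₂ _ (by ring) ?_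
    have e1 : ∀ x : ℝ, (fourier (-m) (x : AddCircle (T - -T)) : ℂ) • F x =
        Complex.exp (-(m * Real.pi * x / T * Complex.I)) * (h x : ℂ) +
        ε * (Complex.exp (-(m * Real.pi * x / T * Complex.I)) * (h (-x) : ℂ)) := by
      intro x
      have e : (fourier (-m) (x : AddCircle (T - -T)) : ℂ) =
          Complex.exp (-(m * Real.pi * x / T * Complex.I)) := by
        rw [fourier_coe_apply]
        congr 1
        have : (T : ℂ) ≠ 0 := by exact_mod_cast hT.ne'
        push_cast
        field_simp
        ring
      rw [e, hF, smul_eq_mul]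
      ring
    have e2 : ∫ x : ℝ, Complex.exp (-(m * Real.pi * x / T * Complex.I)) * (h (-x) : ℂ) =
        ∫ x : ℝ, Complex.exp (m * Real.pi * x / T * Complex.I) * (h x : ℂ) := by
      rw [← integral_neg_eq_self]
      refine integral_congr_ae (Filter.Eventually.of_forall fun x => ?_)
      dsimp only
      rw [neg_neg]
      congr 2
      push_cast; ring
    simp_rw [e1, add_mul]
    rw [integral_add hm (hmn.const_mul _), integral_const_mul, e2, ← integral_const_mul,
      ← integral_add hm (hp.const_mul _)]
    simp_rw [mul_assoc]
  have hnorm : ∫ x in (-T)..T, ‖F x‖ ^ 2 = 2 * ∫ x, h x ^ 2 := by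
    rw [intervalIntegral.integral_of_le hab.le,
      setIntegral_eq_integral_of_forall_compl_eq_zero (fun x hx => by rw [hF0 x hx]; simp)]
    have e1 : ∀ x, ‖F x‖ ^ 2 = h x ^ 2 + h (-x) ^ 2 := by
      intro x
      have hF' : F x = ((h x + ε * h (-x) : ℝ) : ℂ) := by rw [hF]; push_cast; ring
      rw [hF', Complex.norm_real, Real.norm_eq_abs, sq_abs]
      have hz : h x * h (-x) = 0 := by
        by_cases hx : x ∈ Ioo 0 T
        · rw [hs (-x) (fun hx' => by linarith [hx'.1, hx.1]), mul_zero]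
        · rw [hs x hx, zero_mul]
      linear_combination 2 * ε * hz + h (-x) ^ 2 * hε
    simp_rw [e1]
    rw [integral_add h2.integrable_sq h2n.integrable_sq,
      integral_neg_eq_self (fun x => h x ^ 2)]
    ring
  simp_rw [hcoef] at hP
  rw [hnorm] at hP
  have hP' := hP.mul_left ((2 * T) ^ 2)
  convert! hP' using 1
  · funext m
    rw [norm_smul, Real.norm_eq_abs, abs_of_pos (by positivity), ← mul_pow, ← mul_assoc,
      mul_one_div_cancel (by positivity), one_mul]
  · rw [smul_eq_mul]
    field_simp
    ring

theorem hasSum_sq_integral_cos (hT : 0 < T) (h2 : MemLp h 2 volume)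
    (hs : ∀ x ∉ Ioo 0 T, h x = 0) :
    HasSum (fun m : ℤ => (∫ x, Real.cos (m * Real.pi * x / T) * h x) ^ 2) (T * ∫ x, h x ^ 2) := by
  have h1 := (hasSum_sq_reflect hT h2 hs (ε := 1) (by norm_num)).mul_left (1 / 4)
  convert! h1 using 1
  · funext m
    have e : ∀ x : ℝ, (Complex.exp (-(m * Real.pi * x / T * Complex.I)) +
      (1 : ℝ) * Complex.exp (m * Real.pi * x / T * Complex.I)) * (h x : ℂ) =
      ((2 * (Real.cos (m * Real.pi * x / T) * h x) : ℝ) : ℂ) := by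
      intro x
      push_cast
      rw [Complex.cos]
      ring_nf
    simp_rw [e]
    rw [integral_complex_ofReal, integral_const_mul, Complex.norm_real, Real.norm_eq_abs, sq_abs]
    ring
  · ring

theorem hasSum_sq_integral_sin (hT : 0 < T) (h2 : MemLp h 2 volume)
    (hs : ∀ x ∉ Ioo 0 T, h x = 0) :
    HasSum (fun m : ℤ => (∫ x, Real.sin (m * Real.pi * x / T) * h x) ^ 2) (T * ∫ x, h x ^ 2) := by
  have h1 := (hasSum_sq_reflect hT h2 hs (ε := -1) (by norm_num)).mul_left (1 / 4)
  convert! h1 using 1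
  · funext m
    have e : ∀ x : ℝ, (Complex.exp (-(m * Real.pi * x / T * Complex.I)) +
      (-1 : ℝ) * Complex.exp (m * Real.pi * x / T * Complex.I)) * (h x : ℂ) =
      (-Complex.I) * ((2 * (Real.sin (m * Real.pi * x / T) * h x) : ℝ) : ℂ) := by
      intro x
      push_cast
      rw [Complex.sin]
      ring_nf
      rw [Complex.I_sq]
      ring_nf
    simp_rw [e]
    rw [integral_const_mul, integral_complex_ofReal, integral_const_mul, norm_mul, norm_neg,
      Complex.norm_I, one_mul, Complex.norm_real, Real.norm_eq_abs, sq_abs]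
    ring
  · ring

end Parseval

variable {n : ℕ} {T : ℝ}

/-- The derivative of the `j`-th coordinate of `c`, extended by zero. -/
noncomputable def H10.derivCoord (c : H10 n T) (j : Fin n) : ℝ → ℝ :=
  (Ioo 0 T).indicator fun t => deriv c.curve t j

theorem H10.memLp_derivCoord (c : H10 n T) (j : Fin n) : MemLp (c.derivCoord j) 2 volume := by
  rw [H10.derivCoord, memLp_indicator_iff_restrict measurableSet_Ioo]
  exact (EuclideanSpace.proj (𝕜 := ℝ) j).comp_memLp' c.memLp_deriv

theorem H10.memLp_coord (hT : 0 ≤ T) (c : H10 n T) (j : Fin n) :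
    MemLp (fun t => c.curve t j) 2 volume := by
  have hcont : Continuous fun t => c.curve t j :=
    (EuclideanSpace.proj (𝕜 := ℝ) j).continuous.comp (c.continuous_curve hT)
  refine hcont.memLp_of_hasCompactSupport ?_
  refine HasCompactSupport.of_support_subset_isCompact (isCompact_Icc (a := 0) (b := T)) ?_
  refine Function.support_subset_iff'.2 fun t ht => ?_
  rw [c.curve_eq_zero fun h => ht (Ioo_subset_Icc_self h)]
  rfl

/-- Integration by parts against a cosine. -/
theorem H10.integral_cos_mul_derivCoord (hT : 0 < T) (c : H10 n T) (j : Fin n) (m : ℤ) :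
    ∫ x, Real.cos (m * Real.pi * x / T) * c.derivCoord j x =
      m * Real.pi / T * ∫ x, Real.sin (m * Real.pi * x / T) * c.curve x j := by
  have hac : AbsolutelyContinuousOnInterval (fun t => c.curve t j) 0 T :=
    absolutelyContinuous_of_dist_le (K := 1) c.absolutelyContinuous fun x _ y _ => by
      rw [one_mul, Real.dist_eq, dist_eq_norm]
      exact PiLp.norm_apply_le (c.curve x - c.curve y) j
  have hcos : ∀ x : ℝ, HasDerivAt (fun x => Real.cos (m * Real.pi * x / T))
      (-(m * Real.pi / T * Real.sin (m * Real.pi * x / T))) x := by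
    intro x
    have h1 : HasDerivAt (fun x : ℝ => m * Real.pi * x / T) (m * Real.pi / T) x := by
      simpa using ((hasDerivAt_id x).const_mul (m * Real.pi)).div_const T
    convert! h1.cos using 1
    ring
  have hcac : AbsolutelyContinuousOnInterval (fun x => Real.cos (m * Real.pi * x / T)) 0 T := by
    refine ContDiffOn.absolutelyContinuousOnInterval (ContDiff.contDiffOn ?_)
    fun_prop
  have hparts := hcac.integral_mul_deriv_eq_deriv_mul hac
  have hL : ∫ x, Real.cos (m * Real.pi * x / T) * c.derivCoord j x =
      ∫ x in (0 : ℝ)..T, Real.cos (m * Real.pi * x / T) * deriv (fun t => c.curve t j) x := by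
    rw [intervalIntegral.integral_of_le hT.le, integral_Ioc_eq_integral_Ioo,
      ← setIntegral_eq_integral_of_forall_compl_eq_zero (s := Ioo 0 T) (fun x hx => by
        rw [H10.derivCoord, indicator_of_notMem hx, mul_zero])]
    refine integral_congr_ae ?_
    filter_upwards [c.ae_differentiableAt, ae_restrict_mem measurableSet_Ioo] with x hx hxm
    rw [H10.derivCoord, indicator_of_mem hxm]
    have := ((EuclideanSpace.proj (𝕜 := ℝ) j).hasFDerivAt.comp_hasDerivAt x hx.hasDerivAt).deriv
    exact congrArg _ this.symm
  have hR : ∫ x in (0 : ℝ)..T, deriv (fun x => Real.cos (m * Real.pi * x / T)) x * c.curve x j =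
      -(m * Real.pi / T * ∫ x, Real.sin (m * Real.pi * x / T) * c.curve x j) := by
    rw [intervalIntegral.integral_of_le hT.le, integral_Ioc_eq_integral_Ioo,
      setIntegral_eq_integral_of_forall_compl_eq_zero (fun x hx => by
        rw [c.curve_eq_zero hx]; simp), ← integral_const_mul, ← integral_neg]
    refine integral_congr_ae (Filter.Eventually.of_forall fun x => ?_)
    dsimp only
    rw [(hcos x).deriv]
    ring
  rw [hL, hparts, hR, c.curve_zero, c.curve_end]
  simp

/-- The `H¹` inner product with a basis curve is a cosine coefficient of the derivative. -/
theorem H10.inner_sineBasis (c : H10 n T) (k : ℕ) (j : Fin n) :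
    inner ℝ (sineBasis n T k j) c =
      √(2 / T) * (k * Real.pi / T) * ∫ x, Real.cos ((k : ℤ) * Real.pi * x / T) *
        c.derivCoord j x := by
  rw [H10.inner_def, ← integral_const_mul]
  have hsupp : ∀ x ∉ Ioo 0 T, √(2 / T) * (k * Real.pi / T) *
      (Real.cos ((k : ℤ) * Real.pi * x / T) * c.derivCoord j x) = 0 := fun x hx => by
    rw [H10.derivCoord, indicator_of_notMem hx, mul_zero, mul_zero]
  refine Eq.trans ?_ (setIntegral_eq_integral_of_forall_compl_eq_zero hsupp)
  refine setIntegral_congr_fun measurableSet_Ioo fun x hx => ?_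
  have hd : HasDerivAt (sineBasis n T k j).curve
      ((√(2 / T) * (Real.cos (k * Real.pi * x / T) * (k * Real.pi / T))) •
        EuclideanSpace.single j (1 : ℝ)) x := by
    have h1 : HasDerivAt (fun x : ℝ => k * Real.pi * x / T) (k * Real.pi / T) x := by
      simpa using ((hasDerivAt_id x).const_mul (k * Real.pi)).div_const T
    have h2 := (h1.sin.const_mul √(2 / T)).smul_const (EuclideanSpace.single j (1 : ℝ))
    refine h2.congr_of_eventuallyEq ?_
    filter_upwards [isOpen_Ioo.mem_nhds hx] with s hs
    exact indicator_of_mem (f := fun t => (√(2 / T) * Real.sin (k * Real.pi * t / T)) •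
      EuclideanSpace.single j (1 : ℝ)) hs
  rw [hd.deriv, H10.derivCoord, indicator_of_mem hx, real_inner_smul_left,
    EuclideanSpace.inner_single_left]
  simp
  ring

theorem H10.integral_coord_sq_le (hT : 0 < T) {N : ℕ} {v : H10 n T} (hv : v ∈ highModes n T N)
    (j : Fin n) : ∫ x, v.curve x j ^ 2 ≤
      (T / ((N + 1) * Real.pi)) ^ 2 * ∫ x, v.derivCoord j x ^ 2 := by
  have hπ := Real.pi_pos
  have hcos := hasSum_sq_integral_cos hT (v.memLp_derivCoord j)
    (fun x hx => by rw [H10.derivCoord, indicator_of_notMem hx])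
  have hsin := hasSum_sq_integral_sin hT (v.memLp_coord hT.le j)
    (fun x hx => by rw [v.curve_eq_zero hx]; rfl)
  have hzero : ∀ k : ℕ, 1 ≤ k → k ≤ N →
      ∫ x, Real.cos ((k : ℤ) * Real.pi * x / T) * v.derivCoord j x = 0 := by
    intro k hk hkN
    have h1 := (Submodule.mem_orthogonal _ _).1 hv (sineBasis n T k j)
      (Submodule.subset_span ⟨k, hk, hkN, j, rfl⟩)
    rw [v.inner_sineBasis] at h1
    have hk' : (0 : ℝ) < k := by exact_mod_cast hk
    have : √(2 / T) * (k * Real.pi / T) ≠ 0 := by positivity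
    exact (mul_eq_zero.1 h1).resolve_left this
  have hterm : ∀ m : ℤ, (∫ x, Real.sin (m * Real.pi * x / T) * v.curve x j) ^ 2 ≤
      (T / ((N + 1) * Real.pi)) ^ 2 *
        (∫ x, Real.cos (m * Real.pi * x / T) * v.derivCoord j x) ^ 2 := by
    intro m
    rcases eq_or_ne m 0 with rfl | hm0
    · simp only [Int.cast_zero, zero_mul, zero_div, Real.sin_zero, integral_zero,
        zero_pow two_ne_zero]
      positivity
    have hparts := v.integral_cos_mul_derivCoord hT j m
    have hmr : (m : ℝ) ≠ 0 := by exact_mod_cast hm0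
    by_cases hmN : m.natAbs ≤ N
    · have hc : ∫ x, Real.cos (m * Real.pi * x / T) * v.derivCoord j x = 0 := by
        rw [← hzero m.natAbs (Int.natAbs_pos.2 hm0) hmN]
        rcases Int.natAbs_eq m with h | h
        · rw [← h]
        · have h' : ((m.natAbs : ℤ) : ℝ) = -m := by
            have h'' : (m.natAbs : ℤ) = -m := by omega
            rw [h'', Int.cast_neg]
          simp_rw [h', neg_mul, neg_div, Real.cos_neg]
      rw [hc] at hparts
      have : m * Real.pi / T ≠ 0 := div_ne_zero (mul_ne_zero hmr hπ.ne') hT.ne'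
      rw [(mul_eq_zero.1 hparts.symm).resolve_left this, hc]
      simp
    · rw [hparts, mul_pow, ← mul_assoc]
      refine le_mul_of_one_le_left (sq_nonneg _) ?_
      have hm : ((N : ℝ) + 1) ^ 2 ≤ (m : ℝ) ^ 2 := by
        rw [sq_le_sq, abs_of_nonneg (by positivity : (0 : ℝ) ≤ N + 1), ← Int.cast_abs,
          Int.abs_eq_natAbs]
        exact_mod_cast Nat.lt_of_not_le hmN
      have : (T / ((N + 1) * Real.pi)) ^ 2 * (m * Real.pi / T) ^ 2 = m ^ 2 / (N + 1) ^ 2 := by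
        field_simp
      rw [this, one_le_div (by positivity)]
      exact hm
  have := hasSum_le hterm hsin (hcos.mul_left _)
  rw [mul_left_comm] at this
  exact le_of_mul_le_mul_left this hT

/-- Wirtinger's inequality: on `𝒱_N` the lowest frequency is `(N + 1) π / T`. -/
theorem H10.integral_norm_sq_le (hT : 0 < T) {N : ℕ} {v : H10 n T} (hv : v ∈ highModes n T N) :
    ∫ x in Ioo 0 T, ‖v.curve x‖ ^ 2 ≤ (T / ((N + 1) * Real.pi)) ^ 2 * ‖v‖ ^ 2 := by
  have e1 : ∫ x in Ioo 0 T, ‖v.curve x‖ ^ 2 = ∑ j, ∫ x, v.curve x j ^ 2 := by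
    rw [setIntegral_eq_integral_of_forall_compl_eq_zero (fun x hx => by
      rw [v.curve_eq_zero hx]; simp), ← integral_finsetSum _ fun j _ =>
        (v.memLp_coord hT.le j).integrable_sq]
    simp_rw [EuclideanSpace.norm_sq_eq, Real.norm_eq_abs, sq_abs]
  have e2 : ‖v‖ ^ 2 = ∑ j, ∫ x, v.derivCoord j x ^ 2 := by
    rw [← real_inner_self_eq_norm_sq, H10.inner_def, ← integral_finsetSum _ fun j _ =>
        (v.memLp_derivCoord j).integrable_sq]
    refine Eq.trans ?_ (setIntegral_eq_integral_of_forall_compl_eq_zero (s := Ioo 0 T)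
      (fun x hx => by simp [H10.derivCoord, indicator_of_notMem hx]))
    refine setIntegral_congr_fun measurableSet_Ioo fun x hx => ?_
    simp only [H10.derivCoord, indicator_of_mem hx]
    rw [real_inner_self_eq_norm_sq, EuclideanSpace.norm_sq_eq]
    simp_rw [Real.norm_eq_abs, sq_abs]
  rw [e1, e2, Finset.mul_sum]
  exact Finset.sum_le_sum fun j _ => v.integral_coord_sq_le hT hv j


/-! ### Parametric integrals of class `C²` -/

section Parametric

variable {H W : Type*} [NormedAddCommGroup H] [NormedSpace ℝ H] [NormedAddCommGroup W]
  [NormedSpace ℝ W]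

/-- Differentiation under the integral over a compact interval; the tube lemma provides the local
bound on the derivative. -/
theorem hasFDerivAt_integral_of_continuous {F : H → ℝ → W} {F' : H → ℝ → H →L[ℝ] W} (a b : ℝ)
    (hF : ∀ x, Continuous (F x)) (hF' : Continuous (Function.uncurry F'))
    (hd : ∀ x t, HasFDerivAt (fun x => F x t) (F' x t) x) (x₀ : H) :
    HasFDerivAt (fun x => ∫ t in a..b, F x t) (∫ t in a..b, F' x₀ t) x₀ := by
  have hF'x : ∀ x, Continuous (F' x) := fun x => hF'.uncurry_left x
  obtain ⟨M, hM⟩ := (isCompact_uIcc (a := a) (b := b)).exists_bound_of_continuousOn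
    (hF'x x₀).continuousOn
  obtain ⟨u, v, hu, -, hxu, hKv, huv⟩ := generalized_tube_lemma (isCompact_singleton (x := x₀))
    (isCompact_uIcc (a := a) (b := b)) (n := {p | ‖Function.uncurry F' p‖ < M + 1})
    (isOpen_lt hF'.norm continuous_const) (by
      rintro ⟨x, t⟩ ⟨hx, ht⟩
      obtain rfl : x = x₀ := hx
      exact (hM t ht).trans_lt (lt_add_one M))
  refine intervalIntegral.hasFDerivAt_integral_of_dominated_of_fderiv_le (bound := fun _ => M + 1)
    (hu.mem_nhds (hxu rfl)) ?_ ((hF x₀).intervalIntegrable _ _)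
    (hF'x x₀).aestronglyMeasurable ?_ intervalIntegrable_const ?_
  · exact Filter.Eventually.of_forall fun x => (hF x).aestronglyMeasurable
  · refine Filter.Eventually.of_forall fun t ht x hx => ?_
    exact (huv (mk_mem_prod hx (hKv (uIoc_subset_uIcc ht)))).le
  · exact Filter.Eventually.of_forall fun t _ x _ => hd x t

variable {E : Type*} [NormedAddCommGroup E] [NormedSpace ℝ E] {V : E → ℝ} {ev : ℝ → H →L[ℝ] E}
  {l : ℝ → E}

/-- The second derivative in `c` of `V (l t + ev t c)`. -/
noncomputable def integrandHessian (V : E → ℝ) (l : ℝ → E) (ev : ℝ → H →L[ℝ] E) (c : H) (t : ℝ) :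
    H →L[ℝ] H →L[ℝ] ℝ :=
  ((ContinuousLinearMap.compL ℝ H E ℝ).flip (ev t)).comp
    ((hessian V (l t + ev t c)).comp (ev t))

theorem continuous_integrandHessian (hV : ContDiff ℝ 2 V) (hev : Continuous ev)
    (hl : Continuous l) : Continuous (Function.uncurry (integrandHessian V l ev)) := by
  have hp : Continuous fun p : H × ℝ => l p.2 + ev p.2 p.1 :=
    (hl.comp continuous_snd).add ((hev.comp continuous_snd).clm_apply continuous_fst)
  have hh : Continuous (hessian V) :=
    (hV.fderiv_right (m := 1) le_rfl).continuous_fderiv one_ne_zero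
  exact ((ContinuousLinearMap.continuous _).comp (hev.comp continuous_snd)).clm_comp
    ((hh.comp hp).clm_comp (hev.comp continuous_snd))

theorem hasFDerivAt_integral_potential (hV : ContDiff ℝ 2 V) (hev : Continuous ev)
    (hl : Continuous l) (a b : ℝ) (c : H) :
    HasFDerivAt (fun c => ∫ t in a..b, V (l t + ev t c))
      (∫ t in a..b, (fderiv ℝ V (l t + ev t c)).comp (ev t)) c := by
  have hp : Continuous fun p : H × ℝ => l p.2 + ev p.2 p.1 :=
    (hl.comp continuous_snd).add ((hev.comp continuous_snd).clm_apply continuous_fst)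
  refine hasFDerivAt_integral_of_continuous a b
    (F' := fun c t => (fderiv ℝ V (l t + ev t c)).comp (ev t)) (fun c => ?_) ?_ (fun c t => ?_) c
  · exact hV.continuous.comp (hp.comp (Continuous.prodMk_right c))
  · exact ((hV.continuous_fderiv two_ne_zero).comp hp).clm_comp (hev.comp continuous_snd)
  · exact ((hV.differentiable two_ne_zero) _).hasFDerivAt.comp c
      ((ev t).hasFDerivAt.const_add (l t))

theorem hasFDerivAt_fderiv_integral_potential (hV : ContDiff ℝ 2 V) (hev : Continuous ev)
    (hl : Continuous l) (a b : ℝ) (c : H) :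
    HasFDerivAt (fun c => ∫ t in a..b, (fderiv ℝ V (l t + ev t c)).comp (ev t))
      (∫ t in a..b, integrandHessian V l ev c t) c := by
  have hp : Continuous fun p : H × ℝ => l p.2 + ev p.2 p.1 :=
    (hl.comp continuous_snd).add ((hev.comp continuous_snd).clm_apply continuous_fst)
  refine hasFDerivAt_integral_of_continuous a b (F' := integrandHessian V l ev) (fun c => ?_)
    (continuous_integrandHessian hV hev hl) (fun c t => ?_) c
  · exact ((hV.continuous_fderiv two_ne_zero).comp (hp.comp (Continuous.prodMk_right c))).clm_comp
      hev
  · have h1 : HasFDerivAt (fun c => fderiv ℝ V (l t + ev t c))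
        ((hessian V (l t + ev t c)).comp (ev t)) c :=
      (((hV.fderiv_right (m := 1) le_rfl).differentiable one_ne_zero) _).hasFDerivAt.comp c
        ((ev t).hasFDerivAt.const_add (l t))
    exact (((ContinuousLinearMap.compL ℝ H E ℝ).flip (ev t)).hasFDerivAt).comp c h1

theorem contDiff_integral_potential (hV : ContDiff ℝ 2 V) (hev : Continuous ev)
    (hl : Continuous l) (a b : ℝ) : ContDiff ℝ 2 fun c => ∫ t in a..b, V (l t + ev t c) := by
  refine (contDiff_succ_iff_hasFDerivAt (n := 1)).2
    ⟨_, ?_, hasFDerivAt_integral_potential hV hev hl a b⟩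
  refine (contDiff_succ_iff_hasFDerivAt (n := 0)).2
    ⟨_, ?_, hasFDerivAt_fderiv_integral_potential hV hev hl a b⟩
  rw [Nat.cast_zero, contDiff_zero]
  exact intervalIntegral.continuous_parametric_intervalIntegral_of_continuous'
    (continuous_integrandHessian hV hev hl) a b

theorem hessian_integral_potential (hV : ContDiff ℝ 2 V) (hev : Continuous ev)
    (hl : Continuous l) (a b : ℝ) (c x y : H) :
    hessian (fun c => ∫ t in a..b, V (l t + ev t c)) c x y =
      ∫ t in a..b, hessian V (l t + ev t c) (ev t x) (ev t y) := by
  have h1 : fderiv ℝ (fun c => ∫ t in a..b, V (l t + ev t c)) =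
      fun c => ∫ t in a..b, (fderiv ℝ V (l t + ev t c)).comp (ev t) :=
    funext fun c => (hasFDerivAt_integral_potential hV hev hl a b c).fderiv
  have hc : Continuous (integrandHessian V l ev c) :=
    (continuous_integrandHessian hV hev hl).uncurry_left c
  have hcx : Continuous fun t => integrandHessian V l ev c t x := hc.clm_apply continuous_const
  have h2 : hessian (fun c => ∫ t in a..b, V (l t + ev t c)) c =
      ∫ t in a..b, integrandHessian V l ev c t := by
    unfold hessian
    rw [h1]
    exact (hasFDerivAt_fderiv_integral_potential hV hev hl a b c).fderiv
  have h3 : (∫ t in a..b, integrandHessian V l ev c t) x =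
      ∫ t in a..b, integrandHessian V l ev c t x :=
    ContinuousLinearMap.intervalIntegral_apply (hc.intervalIntegrable a b) x
  have h4 : (∫ t in a..b, integrandHessian V l ev c t x) y =
      ∫ t in a..b, integrandHessian V l ev c t x y :=
    ContinuousLinearMap.intervalIntegral_apply (hcx.intervalIntegrable a b) y
  rw [h2, h3, h4]
  rfl

end Parametric

/-! ### The action as half the squared norm minus a potential term -/

variable {n : ℕ} {T : ℝ} {V : Conf n → ℝ} {q₀ qT : Conf n}

theorem action_eq (hT : 0 < T) (hV : ContDiff ℝ 2 V) (q₀ qT : Conf n) (c : H10 n T) :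
    action V q₀ qT c = T / 2 * ‖T⁻¹ • (qT - q₀)‖ ^ 2 + 1 / 2 * ‖c‖ ^ 2 -
      ∫ t in (0 : ℝ)..T, V (q₀ + (t / T) • (qT - q₀) + evalL hT.le t c) := by
  set a := T⁻¹ • (qT - q₀) with ha
  have hpot : IntervalIntegrable (fun t => V (path q₀ qT c t)) volume 0 T := by
    refine (hV.continuous.comp ?_).intervalIntegrable _ _
    exact (by fun_prop : Continuous fun t : ℝ => q₀ + (t / T) • (qT - q₀)).add
      (c.continuous_curve hT.le)
  have hd : ∀ᵐ t ∂(volume.restrict (Ioo 0 T)), 1 / 2 * ‖deriv (path q₀ qT c) t‖ ^ 2 =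
      1 / 2 * ‖a‖ ^ 2 + inner ℝ a (deriv c.curve t) +
        1 / 2 * inner ℝ (deriv c.curve t) (deriv c.curve t) := by
    filter_upwards [c.ae_differentiableAt] with t ht
    have h1 : HasDerivAt (fun t : ℝ => q₀ + (t / T) • (qT - q₀)) a t := by
      have := (((hasDerivAt_id t).div_const T).smul_const (qT - q₀)).const_add q₀
      simpa [ha] using this
    have h2 : deriv (path q₀ qT c) t = a + deriv c.curve t := (h1.add ht.hasDerivAt).deriv
    rw [h2, norm_add_sq_real, real_inner_self_eq_norm_sq]
    ring
  have hi1 : Integrable (fun t => inner ℝ a (deriv c.curve t)) (volume.restrict (Ioo 0 T)) :=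
    c.integrable_deriv.const_inner a
  have hi2 := (c.integrable_inner c).const_mul (1 / 2)
  have hi0 : Integrable (fun _ : ℝ => 1 / 2 * ‖a‖ ^ 2) (volume.restrict (Ioo 0 T)) :=
    integrable_const _
  have hi01 : Integrable (fun t => 1 / 2 * ‖a‖ ^ 2 + inner ℝ a (deriv c.curve t))
      (volume.restrict (Ioo 0 T)) := hi0.add hi1
  have hkin : IntervalIntegrable (fun t => 1 / 2 * ‖deriv (path q₀ qT c) t‖ ^ 2) volume 0 T := by
    rw [intervalIntegrable_iff_integrableOn_Ioo_of_le hT.le]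
    exact (hi01.add hi2).congr (hd.mono fun t ht => ht.symm)
  rw [action, intervalIntegral.integral_sub hkin hpot]
  congr 1
  rw [intervalIntegral.integral_of_le hT.le, integral_Ioc_eq_integral_Ioo, integral_congr_ae hd,
    integral_add hi01 hi2, integral_add hi0 hi1, integral_inner c.integrable_deriv,
    c.integral_deriv_eq_zero hT.le, integral_const, integral_const_mul, ← H10.inner_def,
    real_inner_self_eq_norm_sq, inner_zero_right]
  simp [hT.le]
  ring

theorem contDiff_action (hT : 0 < T) (hV : ContDiff ℝ 2 V) (q₀ qT : Conf n) :
    ContDiff ℝ 2 (action V q₀ qT : H10 n T → ℝ) := by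
  rw [funext (action_eq hT hV q₀ qT)]
  refine (contDiff_const.add (contDiff_const.mul (contDiff_norm_sq ℝ))).sub ?_
  exact contDiff_integral_potential hV (continuous_evalL hT.le) (by fun_prop) 0 T

theorem inner_sub_hessian_action (hT : 0 < T) (hV : ContDiff ℝ 2 V) (q₀ qT : Conf n)
    (c x y : H10 n T) :
    inner ℝ x y - hessian (action V q₀ qT) c x y =
      ∫ t in (0 : ℝ)..T, hessian V (q₀ + (t / T) • (qT - q₀) + c.curve t)
        (x.curve t) (y.curve t) := by
  set G : H10 n T → ℝ := fun c =>
    ∫ t in (0 : ℝ)..T, V (q₀ + (t / T) • (qT - q₀) + evalL hT.le t c) with hG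
  have hl : Continuous fun t : ℝ => q₀ + (t / T) • (qT - q₀) := by fun_prop
  have hGc : ContDiff ℝ 2 G := contDiff_integral_potential hV (continuous_evalL hT.le) hl 0 T
  have h1 : fderiv ℝ (action V q₀ qT : H10 n T → ℝ) = fun c => innerSL ℝ c - fderiv ℝ G c := by
    funext c
    rw [funext (action_eq hT hV q₀ qT)]
    have hn : HasFDerivAt (fun c : H10 n T => ‖c‖ ^ 2) (2 • innerSL ℝ c) c :=
      (hasStrictFDerivAt_norm_sq c).hasFDerivAt
    have h := ((hn.const_mul (1 / 2)).const_add (T / 2 * ‖T⁻¹ • (qT - q₀)‖ ^ 2)).sub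
      ((hGc.differentiable two_ne_zero) c).hasFDerivAt
    refine HasFDerivAt.fderiv (h.congr_fderiv ?_)
    ext z
    simp
  let I : H10 n T →L[ℝ] H10 n T →L[ℝ] ℝ := innerSL ℝ
  have h2 : hessian (action V q₀ qT) c = I - hessian G c := by
    unfold hessian
    rw [h1]
    exact (I.hasFDerivAt.sub
      (((hGc.fderiv_right (m := 1) le_rfl).differentiable one_ne_zero) c).hasFDerivAt).fderiv
  rw [h2]
  have h3 := hessian_integral_potential hV (continuous_evalL hT.le) hl 0 T c x y
  change _ - (inner ℝ x y - hessian G c x y) = _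
  rw [sub_sub_cancel]
  exact h3

/-- On `𝒱_N` the term `∫ V''(γ)(x, y)` is at most `C ∫ |x| |y|`, which Wirtinger's inequality bounds by
the `H¹` norms. -/
theorem hessianClose_action (hT : 0 < T) (hV : ContDiff ℝ 2 V) (q₀ qT : Conf n)
    {C : ℝ} (hC : ∀ q, ‖hessian V q‖ ≤ C) (N : ℕ) :
    HessianClose (action V q₀ qT) (lowModes n T N) (C * (T / ((N + 1) * Real.pi)) ^ 2) := by
  intro c x hx y hy
  have hC0 : 0 ≤ C := (ContinuousLinearMap.opNorm_nonneg _).trans (hC 0)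
  set K := (T / ((N + 1) * Real.pi)) ^ 2 with hK
  rcases eq_or_ne x 0 with rfl | hx0
  · simp
  rcases eq_or_ne y 0 with rfl | hy0
  · simp
  have hx0' := norm_pos_iff.2 hx0
  have hy0' := norm_pos_iff.2 hy0
  have hxc := x.continuous_curve hT.le
  have hyc := y.continuous_curve hT.le
  have hix : IntervalIntegrable (fun t => C / 2 * (‖y‖ / ‖x‖) * ‖x.curve t‖ ^ 2) volume 0 T :=
    (by fun_prop : Continuous _).intervalIntegrable _ _
  have hiy : IntervalIntegrable (fun t => C / 2 * (‖x‖ / ‖y‖) * ‖y.curve t‖ ^ 2) volume 0 T :=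
    (by fun_prop : Continuous _).intervalIntegrable _ _
  rw [inner_sub_hessian_action hT hV, ← Real.norm_eq_abs]
  -- the weighted arithmetic-geometric mean inequality replaces the Cauchy-Schwarz inequality
  refine (intervalIntegral.norm_integral_le_of_norm_le hT.le (Filter.Eventually.of_forall
    fun t _ => ?_) (hix.add hiy)).trans ?_
  · refine ((hessian V _).le_opNorm₂ _ _).trans ?_
    have h1 : ‖x.curve t‖ * ‖y.curve t‖ ≤ 1 / 2 * (‖y‖ / ‖x‖ * ‖x.curve t‖ ^ 2 +
        ‖x‖ / ‖y‖ * ‖y.curve t‖ ^ 2) := by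
      have h2 := sq_nonneg (‖y‖ * ‖x.curve t‖ - ‖x‖ * ‖y.curve t‖)
      have h3 : ‖y‖ / ‖x‖ * ‖x.curve t‖ ^ 2 + ‖x‖ / ‖y‖ * ‖y.curve t‖ ^ 2 =
          ((‖y‖ * ‖x.curve t‖) ^ 2 + (‖x‖ * ‖y.curve t‖) ^ 2) / (‖x‖ * ‖y‖) := by
        field_simp
      rw [h3, ← mul_div_assoc, le_div_iff₀ (by positivity)]
      linarith
    calc _ ≤ C * ‖x.curve t‖ * ‖y.curve t‖ := by gcongr; exact hC _
      _ = C * (‖x.curve t‖ * ‖y.curve t‖) := by ring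
      _ ≤ C * (1 / 2 * (‖y‖ / ‖x‖ * ‖x.curve t‖ ^ 2 + ‖x‖ / ‖y‖ * ‖y.curve t‖ ^ 2)) := by gcongr
      _ = _ := by ring
  · rw [intervalIntegral.integral_add hix hiy, intervalIntegral.integral_const_mul,
      intervalIntegral.integral_const_mul]
    simp only [intervalIntegral.integral_of_le hT.le, integral_Ioc_eq_integral_Ioo]
    calc _ ≤ C / 2 * (‖y‖ / ‖x‖) * (K * ‖x‖ ^ 2) + C / 2 * (‖x‖ / ‖y‖) * (K * ‖y‖ ^ 2) := by
          gcongr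
          · exact x.integral_norm_sq_le hT hx
          · exact y.integral_norm_sq_le hT hy
      _ = C * K * ‖x‖ * ‖y‖ := by field_simp; ring

theorem contraction_constant_lt_one (hT : 0 < T) {C : ℝ} (hC : 0 ≤ C) {N : ℕ}
    (hN : ⌊T * √C / Real.pi⌋ ≤ (N : ℤ)) : C * (T / ((N + 1) * Real.pi)) ^ 2 < 1 := by
  have hπ := Real.pi_pos
  have h1 : T * √C / Real.pi < N + 1 := by
    have := Int.floor_lt.1 (Int.lt_add_one_iff.2 hN)
    exact_mod_cast this
  have h2 : (T * √C / Real.pi) ^ 2 < (N + 1) ^ 2 := pow_lt_pow_left₀ h1 (by positivity) two_ne_zero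
  rw [div_pow, mul_pow, Real.sq_sqrt hC, div_lt_iff₀ (by positivity)] at h2
  rw [div_pow, mul_pow, ← mul_div_assoc, div_lt_one (by positivity)]
  linarith

/-! ### Finite-dimensionality of the low modes -/

theorem rank_lowModes_le (n : ℕ) (T : ℝ) (N : ℕ) :
    Module.rank ℝ (lowModes n T N) ≤ ((n * N : ℕ) : Cardinal) := by
  have h : {c : H10 n T | ∃ k : ℕ, 1 ≤ k ∧ k ≤ N ∧ ∃ j : Fin n, c = sineBasis n T k j} ⊆
      range fun p : Fin n × Fin N => sineBasis n T (p.2 + 1) p.1 := by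
    rintro c ⟨k, hk1, hkN, j, rfl⟩
    refine ⟨(j, ⟨k - 1, by omega⟩), ?_⟩
    simp [Nat.sub_add_cancel hk1]
  refine (rank_span_le _).trans ((Cardinal.mk_le_mk_of_subset h).trans ?_)
  refine Cardinal.mk_range_le.trans ?_
  simp

instance finiteDimensional_lowModes (n : ℕ) (T : ℝ) (N : ℕ) :
    FiniteDimensional ℝ (lowModes n T N) :=
  Module.rank_lt_aleph0_iff.1 ((rank_lowModes_le n T N).trans_lt (Cardinal.natCast_lt_aleph0))

end Reduction

theorem proposition4 (n : ℕ) (T : ℝ) (hT : 0 < T) (q₀ qT : Reduction.Conf n)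
    (V : Reduction.Conf n → ℝ) (hV : ContDiff ℝ 2 V)
    (C : ℝ) (hC : IsLUB (Set.range fun q => ‖Reduction.hessian V q‖) C)
    (N : ℕ) (hN : ⌊T * √C / Real.pi⌋ ≤ (N : ℤ))
    (L : Reduction.H10 n T → ℝ) (hL : L = Reduction.action V q₀ qT) :
    ContDiff ℝ 2 L ∧
    (∃ w : Reduction.lowModes n T N → Reduction.highModes n T N, Reduction.IsReduction L N w) ∧
    ∀ w : Reduction.lowModes n T N → Reduction.highModes n T N, Reduction.IsReduction L N w →
      ContDiff ℝ 1 w ∧ ContDiff ℝ 2 (Reduction.reduced L w) ∧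
      ∀ u : Reduction.lowModes n T N,
        (fderiv ℝ (Reduction.reduced L w) u = 0 ↔ fderiv ℝ L (Reduction.lift w u) = 0) ∧
        (fderiv ℝ L (Reduction.lift w u) = 0 →
          Reduction.index (Reduction.hessian L (Reduction.lift w u)) =
            Reduction.index (Reduction.hessian (Reduction.reduced L w) u) ∧
          Reduction.nullity (Reduction.hessian L (Reduction.lift w u)) =
            Reduction.nullity (Reduction.hessian (Reduction.reduced L w) u) ∧
          Reduction.index (Reduction.hessian L (Reduction.lift w u)) ≤ ((n * N : ℕ) : ℕ∞)) := by
  have := Reduction.completeSpace_H10 (n := n) hT.le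
  have hCb : ∀ q, ‖Reduction.hessian V q‖ ≤ C := fun q => hC.1 ⟨q, rfl⟩
  have hC0 : 0 ≤ C := (ContinuousLinearMap.opNorm_nonneg _).trans (hCb 0)
  have hL2 : ContDiff ℝ 2 L := hL ▸ Reduction.contDiff_action hT hV q₀ qT
  have hclose : Reduction.HessianClose L (Reduction.lowModes n T N)
      (C * (T / ((N + 1) * Real.pi)) ^ 2) :=
    hL ▸ Reduction.hessianClose_action hT hV q₀ qT hCb N
  have hκ1 := Reduction.contraction_constant_lt_one hT hC0 hN
  have hκ0 : 0 ≤ C * (T / ((N + 1) * Real.pi)) ^ 2 := by positivity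
  refine ⟨hL2, ?_, fun w hw => ?_⟩
  · choose w hw hw' using Reduction.existsUnique_vertical_critical hL2 hκ0 hκ1 hclose
    exact ⟨w, fun u v => ⟨hw' u v, fun h => h ▸ hw u⟩⟩
  · have hwc : ContDiff ℝ 1 w := Reduction.contDiff_vertical_critical hL2 hκ0 hκ1 hclose hw
    refine ⟨hwc, Reduction.contDiff_two_reduced hL2 hwc hw, fun u =>
      ⟨Reduction.fderiv_reduced_eq_zero_iff hL2 hwc hw u, fun _ => ?_⟩⟩
    have hsymm : ∀ x y, Reduction.hessian L (Reduction.lift w u) x y =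
        Reduction.hessian L (Reduction.lift w u) y x :=
      fun x y => (hL2.contDiffAt.isSymmSndFDerivAt (by simp)) x y
    have hpos : ∀ v ∈ (Reduction.lowModes n T N)ᗮ, v ≠ 0 →
        0 < Reduction.hessian L (Reduction.lift w u) v v := by
      intro v hv hv0
      have h1 := (le_abs_self _).trans (hclose (Reduction.lift w u) v hv v hv)
      rw [real_inner_self_eq_norm_sq] at h1
      have h2 : 0 < ‖v‖ ^ 2 := by have := norm_pos_iff.2 hv0; positivity
      nlinarith
    have hD := fun a : Reduction.lowModes n T N =>
      (Reduction.hessian_lift hL2 hwc hw u a).1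
    have hS := fun a : Reduction.lowModes n T N =>
      (Reduction.hessian_lift hL2 hwc hw u a).2
    have hidx := Reduction.index_eq_of_graph hsymm hpos hD hS
    refine ⟨hidx, Reduction.nullity_eq_of_graph hpos hD hS, ?_⟩
    exact hidx.le.trans (Reduction.index_le_of_rank_le _ (Reduction.rank_lowModes_le n T N))
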